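/- Let $p$ be a prime, let $|\cdot|_p$ be the $p$-adic norm on $\mathbb{Q}_p$, and let $dy$ be the Haar measure on $(\mathbb{Q}_p,+)$ with $\int_{\mathbb{Z}_p}dy=1$. For $\alpha>0$, $f:\mathbb{Q}_p\to\mathbb{C}$ and $x\in\mathbb{Q}_p$ put $$D^\alpha f(x)=\frac{p^\alpha-1}{1-p^{-\alpha-1}}\int_{\mathbb{Q}_p}\frac{f(x)-f(y)}{|x-y|_p^{\alpha+1}}\,dy ,$$ and say that $D^\alpha f(x)$ is defined if this integral converges absolutely. For real $u\neq 0$ put $\Gamma_p(u)=\dfrac{1-p^{u-1}}{1-p^{-u}}$. (1) Let $\alpha,\beta>0$. If $f:\mathbb{Q}_p\to\mathbb{C}$ is such that $D^\beta f$ is defined at every point of $\mathbb{Q}_p$, and $D^\alpha[D^\beta f]$ is defined at $x$, then $D^{\alpha+\beta}f(x)$ is defined and $$D^\alpha[D^\beta f](x)=D^{\alpha+\beta}f(x).$$ If $f$ is locally constant with compact support, then $D^\beta f$, $D^\alpha[D^\beta f]$ and $D^{\alpha+\beta}f$ are defined at every point of $\mathbb{Q}_p$, and the identity holds at every point. (2)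 Let $n\ge 0$ be an integer, $\alpha>0$ and $x\in\mathbb{Q}_p\setminus\{0\}$. For every $s\in\mathbb{C}$ with $-1<\operatorname{Re}s<\alpha$, $D^\alpha|\cdot|_p^s$ is defined at $x$. If $\alpha\neq n$, then $$D^\alpha|x|_p^n=\frac{\Gamma_p(n+1)}{\Gamma_p(n-\alpha+1)}\,|x|_p^{n-\alpha},$$ where the right-hand side is read as $0$ if $\alpha=n+1$ (where $\Gamma_p(n-\alpha+1)$ has a pole). Here, if $n<\alpha$, the left-hand side is given by the convergent integral. For every $n$ (in particular for $n>\alpha$, where the integral diverges) the left-hand side may be taken as the value at $s=n$ of an analytic continuation of $s\mapsto D^\alpha|\cdot|_p^s(x)$ from the strip $-1<\operatorname{Re}s<\alpha$ to a connected open set containing $n$; such a continuation exists, and every such continuation takes the stated value at $n$. -/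

import Mathlib

open MeasureTheory

noncomputable section

/-- The Borel `σ`-algebra on `ℚ_[p]`. -/
instance padicMeasurableSpace (p : ℕ) [Fact p.Prime] : MeasurableSpace ℚ_[p] := borel ℚ_[p]

instance padicBorelSpace (p : ℕ) [Fact p.Prime] : BorelSpace ℚ_[p] := ⟨rfl⟩

/-- The closed unit ball of `ℚ_[p]` (the set of `p`-adic integers), as a compact set with nonempty
interior. -/
def padicUnitBall (p : ℕ) [Fact p.Prime] : TopologicalSpace.PositiveCompacts ℚ_[p] where
  carrier := Metric.closedBall 0 1
  isCompact' := isCompact_closedBall 0 1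
  interior_nonempty' :=
    ⟨0, Metric.ball_subset_interior_closedBall (Metric.mem_ball_self one_pos)⟩

/-- The Haar measure `dx` on `(ℚ_[p], +)`, normalised so that the `p`-adic integers have
measure `1`. -/
def padicHaar (p : ℕ) [Fact p.Prime] : Measure ℚ_[p] :=
  Measure.addHaarMeasure (padicUnitBall p)

theorem padicHaar_closedBall (p : ℕ) [Fact p.Prime] :
    padicHaar p (Metric.closedBall 0 1) = 1 :=
  Measure.addHaarMeasure_self (K₀ := padicUnitBall p)

/-- The `p`-adic Gamma function `Γ_p(x) = (1 - p^(x-1)) / (1 - p^(-x))`, for real `x ≠ 0`. -/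
def padicGamma (p : ℕ) (x : ℝ) : ℝ :=
  (1 - (p : ℝ) ^ (x - 1)) / (1 - (p : ℝ) ^ (-x))

/-- The function `y ↦ (f(x) - f(y)) / |x - y|_p^(α+1)` under the integral that defines
`D^α f(x)`. -/
def vladimirovIntegrand (p : ℕ) [Fact p.Prime] (α : ℝ) (f : ℚ_[p] → ℂ) (x y : ℚ_[p]) : ℂ :=
  (f x - f y) / ((‖x - y‖ ^ (α + 1) : ℝ) : ℂ)

/-- `D^α f(x)` is defined: the integral defining it converges (absolutely). -/
def VladimirovDefinedAt (p : ℕ) [Fact p.Prime] (α : ℝ) (f : ℚ_[p] → ℂ) (x : ℚ_[p]) : Prop :=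
  Integrable (vladimirovIntegrand p α f x) (padicHaar p)

/-- The Vladimirov operator
`D^α f(x) = (p^α - 1) / (1 - p^(-α-1)) * ∫ (f(x) - f(y)) / |x - y|_p^(α+1) dy`. -/
def vladimirov (p : ℕ) [Fact p.Prime] (α : ℝ) (f : ℚ_[p] → ℂ) (x : ℚ_[p]) : ℂ :=
  ((((p : ℝ) ^ α - 1) / (1 - (p : ℝ) ^ (-α - 1)) : ℝ) : ℂ) *
    ∫ y, vladimirovIntegrand p α f x y ∂(padicHaar p)

/-- The complex power `|y|_p^s` of the `p`-adic norm. -/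
def padicNormPow (p : ℕ) [Fact p.Prime] (s : ℂ) (y : ℚ_[p]) : ℂ :=
  ((‖y‖ : ℝ) : ℂ) ^ s

/-- `v` is the value at `z` of an analytic continuation of `Φ : S → ℂ`: some analytic function on
a connected open set containing `S` and `z` equals `Φ` on `S` and takes the value `v` at `z`. -/
def IsContinuedValue (S : Set ℂ) (Φ : ℂ → ℂ) (z v : ℂ) : Prop :=
  ∃ (U : Set ℂ) (F : ℂ → ℂ), IsOpen U ∧ IsConnected U ∧ S ⊆ U ∧ z ∈ U ∧
    AnalyticOnNhd ℂ F U ∧ Set.EqOn F Φ S ∧ F z = v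

/-- `v` is the value of `D^α |·|_p^n` at `x` understood by analytic continuation in the exponent:
`s ↦ D^α |·|_p^s (x)`, given by the integral on the strip `-1 < Re s < α`, is continued
to `s = n`. -/
def IsContinuedVladimirovPow (p : ℕ) [Fact p.Prime] (α : ℝ) (n : ℕ) (x : ℚ_[p]) (v : ℂ) : Prop :=
  IsContinuedValue {s : ℂ | -1 < s.re ∧ s.re < α}
    (fun s => vladimirov p α (padicNormPow p s) x) (n : ℂ) v

end

/-!
The operators `D^α` are multipliers on the `p`-adic scales. Write `E_k f` for the average of `f`
over balls of radius `p ^ k` (`ballAvg`) and `Δ_k f = E_{k-1} f - E_k f` (`ballDiff`). Cutting the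
integral for `D^α f (x)` into spheres about `x` and summing by parts gives
`D^α f (x) = ∑ k, p ^ (α (1 - k)) Δ_k f (x)` (`VladimirovDefinedAt.hasSum`), whenever the
integral converges. The semigroup law then amounts to `Δ_k (D^β f) = p ^ (β (1 - k)) Δ_k f` (`ballDiff_vladimirov`).

For general `f` this last identity is not a matter of exchanging integrals, since the double
integral need not converge absolutely. It says that `E_k (D^β f)` is the partial sum
`G_k = ∑ j > k, p ^ (β (1 - j)) Δ_j f`. The `G_k` form a martingale which converges to `D^β f` at every point,
and `D^β f` is locally integrable. As in the theorem that a derivative which exists everywhere and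
is integrable integrates back to the function, convergence *everywhere* suffices
(`le_ballAvg_of_tendsto`): for a lower semicontinuous `u > D^β f` of nearly the same integral, if
`E_k u - G_k` were negative on some ball it would be at most as large on one of its subballs, and
these would shrink to a point at which the limit is positive.

Convergence of the integral for `D^(α+β) f (x)` (`VladimirovDefinedAt.add`) comes from
reconstructing `f - E_i f` out of the differences of `D^β f`, which are bounded in `L¹` by the
oscillation of `D^β f` about `x`, and summing geometric series over the scales. For `f` locally
constant with compact support, `D^β f` is again bounded and uniformly locally constant, and this
is enough for all integrals to converge.

For powers of the norm, `‖x - y‖ = max ‖x‖ ‖y‖` off the sphere through `x`, and on that sphere the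
integrand vanishes. So the integral is a sum of four geometric series, with the value
`vladimirovPowValue`; this is analytic in `s` off a countable closed set, whose complement is
connected, and the identity theorem settles the continued value.
-/

open Filter Topology Metric
open scoped ENNReal

section

variable {p : ℕ} [hp : Fact p.Prime]

/-! ### Balls and spheres -/

instance : (padicHaar p).IsAddHaarMeasure := by unfold padicHaar; infer_instance

instance : (padicHaar p).Regular := by unfold padicHaar; infer_instance

theorem one_lt_cast_prime : (1 : ℝ) < p := mod_cast hp.out.one_lt

theorem cast_prime_pos : (0 : ℝ) < p := mod_cast hp.out.pos

theorem padic_closedBall_eq {x y : ℚ_[p]} {r : ℝ} (h : ‖x - y‖ ≤ r) :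
    closedBall x r = closedBall y r :=
  (IsUltrametricDist.closedBall_eq_of_mem (by rwa [mem_closedBall, dist_eq_norm])).symm

/-- A ball of radius `p ^ (k + 1)` is the union of `p` balls of radius `p ^ k`. -/
theorem padic_closedBall_succ (x : ℚ_[p]) (k : ℤ) :
    closedBall x ((p : ℝ) ^ (k + 1)) =
      ⋃ a : Fin p, closedBall (x + (a : ℕ) * (p : ℚ_[p]) ^ (-(k + 1))) ((p : ℝ) ^ k) := by
  have hpp := cast_prime_pos (p := p)
  have hp0 : (p : ℚ_[p]) ≠ 0 := mod_cast hp.out.ne_zero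
  ext y
  simp only [Set.mem_iUnion, mem_closedBall, dist_eq_norm]
  constructor
  · intro h
    have h1 : ‖(y - x) * (p : ℚ_[p]) ^ (k + 1)‖ ≤ 1 := by
      rw [norm_mul, Padic.norm_p_zpow, zpow_neg]
      exact mul_inv_le_one_of_le₀ h (by positivity)
    obtain ⟨n, hn, hm⟩ := PadicInt.exists_mem_range (⟨_, h1⟩ : ℤ_[p])
    refine ⟨⟨n, hn⟩, ?_⟩
    rw [PadicInt.maximalIdeal_eq_span_p, Ideal.mem_span_singleton, ← PadicInt.norm_lt_one_iff_dvd,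
      PadicInt.norm_def] at hm
    have h2 : y - (x + (n : ℕ) * (p : ℚ_[p]) ^ (-(k + 1))) =
        ((y - x) * (p : ℚ_[p]) ^ (k + 1) - n) * (p : ℚ_[p]) ^ (-(k + 1)) := by
      rw [zpow_neg]; field_simp; ring
    rw [Padic.norm_le_pow_iff_norm_lt_pow_add_one, h2, norm_mul, Padic.norm_p_zpow, neg_neg]
    exact mul_lt_of_lt_one_left (by positivity) hm
  · rintro ⟨a, ha⟩
    have h2 : y - x = (y - (x + (a : ℕ) * (p : ℚ_[p]) ^ (-(k + 1)))) +
        (a : ℕ) * (p : ℚ_[p]) ^ (-(k + 1)) := by ring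
    rw [h2]
    refine (IsUltrametricDist.norm_add_le_max _ _).trans (max_le (ha.trans ?_) ?_)
    · exact zpow_le_zpow_right₀ one_lt_cast_prime.le (by lia)
    · rw [norm_mul, Padic.norm_p_zpow, neg_neg]
      exact mul_le_of_le_one_left (by positivity) (mod_cast Padic.norm_int_le_one (a : ℤ))

/-- The `p` balls in the decomposition `padic_closedBall_succ` are disjoint. -/
theorem padic_closedBall_pairwise_disjoint (x : ℚ_[p]) (k : ℤ) :
    Pairwise (Function.onFun Disjoint fun a : Fin p =>
      closedBall (x + (a : ℕ) * (p : ℚ_[p]) ^ (-(k + 1))) ((p : ℝ) ^ k)) := by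
  have hpp := cast_prime_pos (p := p)
  intro a b hab
  refine Set.disjoint_left.mpr fun y hy hz => ?_
  rw [mem_closedBall, dist_eq_norm] at hy hz
  rw [norm_sub_rev] at hz
  have h := (IsUltrametricDist.norm_add_le_max _ _).trans (max_le hy hz)
  have h2 : y - (x + (a : ℕ) * (p : ℚ_[p]) ^ (-(k + 1))) +
      (x + (b : ℕ) * (p : ℚ_[p]) ^ (-(k + 1)) - y) =
      (((b : ℕ) - (a : ℕ) : ℤ) : ℚ_[p]) * (p : ℚ_[p]) ^ (-(k + 1)) := by push_cast; ring
  rw [Padic.norm_le_pow_iff_norm_lt_pow_add_one, h2, norm_mul, Padic.norm_p_zpow, neg_neg,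
    mul_lt_iff_lt_one_left (by positivity), Padic.norm_intCast_lt_one_iff] at h
  refine hab (Fin.ext ?_)
  have := Int.eq_zero_of_abs_lt_dvd h (by have := a.2; have := b.2; rw [abs_lt]; omega)
  lia

theorem lintegral_padic_closedBall_succ (f : ℚ_[p] → ℝ≥0∞) (x : ℚ_[p]) (k : ℤ) :
    ∫⁻ y in closedBall x ((p : ℝ) ^ (k + 1)), f y ∂padicHaar p =
      ∑ a : Fin p, ∫⁻ y in closedBall (x + (a : ℕ) * (p : ℚ_[p]) ^ (-(k + 1))) ((p : ℝ) ^ k),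
        f y ∂padicHaar p := by
  rw [padic_closedBall_succ, lintegral_iUnion (fun _ => measurableSet_closedBall)
    (padic_closedBall_pairwise_disjoint x k), tsum_fintype]

theorem padicHaar_closedBall_eq_zero_center (x : ℚ_[p]) (r : ℝ) :
    padicHaar p (closedBall x r) = padicHaar p (closedBall 0 r) := by
  rw [← measure_preimage_add (padicHaar p) x]
  congr 1; ext y; simp [dist_eq_norm]

theorem padicHaar_closedBall_succ (x : ℚ_[p]) (k : ℤ) :
    padicHaar p (closedBall x ((p : ℝ) ^ (k + 1))) =
      p * padicHaar p (closedBall x ((p : ℝ) ^ k)) := by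
  have h := lintegral_padic_closedBall_succ (fun _ => 1) x k
  simp only [setLIntegral_one] at h
  rw [h, Finset.sum_congr rfl fun a _ => (padicHaar_closedBall_eq_zero_center _ _).trans
    (padicHaar_closedBall_eq_zero_center x _).symm]
  simp

theorem padicHaar_closedBall_zpow (x : ℚ_[p]) (k : ℤ) :
    padicHaar p (closedBall x ((p : ℝ) ^ k)) = (p : ℝ≥0∞) ^ k := by
  have hp0 : (p : ℝ≥0∞) ≠ 0 := mod_cast hp.out.ne_zero
  induction k with
  | zero => simpa using (padicHaar_closedBall_eq_zero_center x 1).trans (padicHaar_closedBall p)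
  | succ k ih =>
    rw [padicHaar_closedBall_succ, ih, ENNReal.zpow_add hp0 (ENNReal.natCast_ne_top p), zpow_one,
      mul_comm]
  | pred k ih =>
    have h := padicHaar_closedBall_succ x (-(k : ℤ) - 1)
    rw [sub_add_cancel, ih, show (-(k : ℤ)) = (-(k : ℤ) - 1) + 1 by ring,
      ENNReal.zpow_add hp0 (ENNReal.natCast_ne_top p), zpow_one, mul_comm] at h
    rw [add_sub_cancel_right] at h
    exact ((ENNReal.mul_right_inj hp0 (ENNReal.natCast_ne_top p)).mp h).symm

theorem padicHaar_real_closedBall_zpow (x : ℚ_[p]) (k : ℤ) :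
    (padicHaar p).real (closedBall x ((p : ℝ) ^ k)) = (p : ℝ) ^ k := by
  rw [measureReal_def, padicHaar_closedBall_zpow]
  rcases k.eq_nat_or_neg with ⟨n, rfl | rfl⟩ <;> simp [ENNReal.zpow_neg]

theorem padicHaar_closedBall_ne_zero (x : ℚ_[p]) (k : ℤ) :
    padicHaar p (closedBall x ((p : ℝ) ^ k)) ≠ 0 :=
  (measure_closedBall_pos _ _ (zpow_pos cast_prime_pos k)).ne'

theorem padicHaar_closedBall_ne_top (x : ℚ_[p]) (r : ℝ) :
    padicHaar p (closedBall x r) ≠ ∞ :=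
  (isCompact_closedBall x r).measure_lt_top.ne

/-- `ℚ_[p]` minus a point is the disjoint union of the spheres of radius `p ^ k` about it. -/
theorem iUnion_padic_sphere (x : ℚ_[p]) : ⋃ k : ℤ, sphere x ((p : ℝ) ^ k) = {x}ᶜ := by
  ext y
  simp only [Set.mem_iUnion, mem_sphere, dist_eq_norm, Set.mem_compl_iff, Set.mem_singleton_iff]
  constructor
  · rintro ⟨k, hk⟩ rfl
    exact (zpow_pos cast_prime_pos k).ne (by simpa using hk)
  · intro h
    exact ⟨_, Padic.norm_eq_zpow_neg_valuation (sub_ne_zero.mpr h)⟩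

theorem padic_sphere_pairwise_disjoint (x : ℚ_[p]) :
    Pairwise (Function.onFun Disjoint fun k : ℤ => sphere x ((p : ℝ) ^ k)) := by
  intro i j hij
  refine Set.disjoint_left.mpr fun y hy hz => hij ?_
  exact zpow_right_injective₀ cast_prime_pos one_lt_cast_prime.ne'
    (hy.symm.trans hz)

theorem padic_closedBall_eq_union (x : ℚ_[p]) (k : ℤ) :
    closedBall x ((p : ℝ) ^ k) = sphere x ((p : ℝ) ^ k) ∪ closedBall x ((p : ℝ) ^ (k - 1)) := by
  ext y
  simp only [Set.mem_union, mem_closedBall, mem_sphere, dist_eq_norm]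
  rw [Padic.norm_le_pow_iff_norm_lt_pow_add_one _ (k - 1), sub_add_cancel, le_iff_lt_or_eq, or_comm]

theorem padic_sphere_disjoint_closedBall (x : ℚ_[p]) (k : ℤ) :
    Disjoint (sphere x ((p : ℝ) ^ k)) (closedBall x ((p : ℝ) ^ (k - 1))) := by
  refine Set.disjoint_left.mpr fun y hy hz => ?_
  simp only [mem_closedBall, mem_sphere] at hy hz
  rw [hy] at hz
  exact absurd (zpow_lt_zpow_right₀ (one_lt_cast_prime (p := p)) (sub_one_lt k)) hz.not_gt

theorem padicHaar_real_sphere (x : ℚ_[p]) (k : ℤ) :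
    (padicHaar p).real (sphere x ((p : ℝ) ^ k)) = (p : ℝ) ^ k * (1 - (p : ℝ)⁻¹) := by
  have h := measureReal_union (μ := padicHaar p) (padic_sphere_disjoint_closedBall x k)
    measurableSet_closedBall
    (measure_ne_top_of_subset sphere_subset_closedBall (padicHaar_closedBall_ne_top x _))
    (padicHaar_closedBall_ne_top x _)
  rw [← padic_closedBall_eq_union, padicHaar_real_closedBall_zpow,
    padicHaar_real_closedBall_zpow, zpow_sub_one₀ cast_prime_pos.ne'] at h
  linarith

theorem lintegral_eq_tsum_padic_sphere (f : ℚ_[p] → ℝ≥0∞) (x : ℚ_[p]) :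
    ∫⁻ y, f y ∂padicHaar p = ∑' k : ℤ, ∫⁻ y in sphere x ((p : ℝ) ^ k), f y ∂padicHaar p := by
  rw [← lintegral_iUnion (fun _ => isClosed_sphere.measurableSet)
    (padic_sphere_pairwise_disjoint x), iUnion_padic_sphere, restrict_compl_singleton]

theorem hasSum_integral_padic_sphere {f : ℚ_[p] → ℂ} (hf : Integrable f (padicHaar p))
    (x : ℚ_[p]) :
    HasSum (fun k : ℤ => ∫ y in sphere x ((p : ℝ) ^ k), f y ∂padicHaar p)
      (∫ y, f y ∂padicHaar p) := by
  have h := hasSum_integral_iUnion (fun _ => isClosed_sphere.measurableSet)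
    (padic_sphere_pairwise_disjoint x) hf.integrableOn
  rwa [iUnion_padic_sphere, restrict_compl_singleton] at h

theorem lintegral_padic_closedBall_eq_tsum (f : ℚ_[p] → ℝ≥0∞) (x : ℚ_[p]) (k : ℤ) :
    ∫⁻ y in closedBall x ((p : ℝ) ^ k), f y ∂padicHaar p =
      ∑' n : ℕ, ∫⁻ y in sphere x ((p : ℝ) ^ (k - n)), f y ∂padicHaar p := by
  have hset : (⋃ n : ℕ, sphere x ((p : ℝ) ^ (k - n))) = closedBall x ((p : ℝ) ^ k) \ {x} := by
    ext y
    simp only [Set.mem_iUnion, mem_sphere, Set.mem_sdiff, mem_closedBall, Set.mem_singleton_iff]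
    constructor
    · rintro ⟨n, hn⟩
      rw [hn]
      refine ⟨zpow_le_zpow_right₀ one_lt_cast_prime.le (by lia), ?_⟩
      rintro rfl
      exact (zpow_pos cast_prime_pos _).ne (by simpa using hn)
    · rintro ⟨h1, h2⟩
      obtain ⟨j, hj⟩ := Set.mem_iUnion.mp ((iUnion_padic_sphere x).ge h2)
      rw [mem_sphere] at hj
      rw [hj, zpow_le_zpow_iff_right₀ one_lt_cast_prime] at h1
      exact ⟨(k - j).toNat, by rw [hj]; congr 1; lia⟩
  rw [← lintegral_iUnion (fun _ => isClosed_sphere.measurableSet), hset]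
  · exact (setLIntegral_congr (sdiff_null_ae_eq_self (measure_singleton x))).symm
  · intro i j hij
    exact padic_sphere_pairwise_disjoint x (by lia)

/-! ### Averages over balls -/

section BallAvg

variable {E : Type*} [NormedAddCommGroup E] [NormedSpace ℝ E]

/-- The average of `f` over the ball of radius `p ^ k` about `x`. -/
noncomputable def ballAvg (k : ℤ) (f : ℚ_[p] → E) (x : ℚ_[p]) : E :=
  ⨍ y in closedBall x ((p : ℝ) ^ k), f y ∂padicHaar p

theorem ballAvg_eq (k : ℤ) (f : ℚ_[p] → E) (x : ℚ_[p]) :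
    ballAvg k f x =
      ((p : ℝ) ^ k)⁻¹ • ∫ y in closedBall x ((p : ℝ) ^ k), f y ∂padicHaar p := by
  rw [ballAvg, setAverage_eq, padicHaar_real_closedBall_zpow]

theorem ballAvg_eq_of_norm_sub_le (f : ℚ_[p] → E) {k : ℤ} {x y : ℚ_[p]}
    (h : ‖x - y‖ ≤ (p : ℝ) ^ k) : ballAvg k f x = ballAvg k f y := by
  rw [ballAvg, ballAvg, padic_closedBall_eq h]

theorem continuous_of_eq_of_norm_sub_le {X : Type*} [TopologicalSpace X] {g : ℚ_[p] → X} {k : ℤ}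
    (hg : ∀ x y, ‖x - y‖ ≤ (p : ℝ) ^ k → g x = g y) : Continuous g := by
  refine IsLocallyConstant.continuous ((IsLocallyConstant.iff_eventually_eq g).mpr fun x => ?_)
  filter_upwards [closedBall_mem_nhds x (zpow_pos (cast_prime_pos (p := p)) k)] with y hy
  exact hg y x (by rwa [mem_closedBall, dist_eq_norm] at hy)

theorem continuous_ballAvg (k : ℤ) (f : ℚ_[p] → E) : Continuous (ballAvg k f) :=
  continuous_of_eq_of_norm_sub_le fun _ _ => ballAvg_eq_of_norm_sub_le f

omit [NormedSpace ℝ E] in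
theorem MeasureTheory.LocallyIntegrable.integrableOn_padic {f : ℚ_[p] → E}
    (hf : LocallyIntegrable f (padicHaar p)) (x : ℚ_[p]) (r : ℝ) :
    IntegrableOn f (closedBall x r) (padicHaar p) :=
  hf.integrableOn_isCompact (isCompact_closedBall x r)

theorem integral_padic_closedBall_succ {f : ℚ_[p] → E} (hf : LocallyIntegrable f (padicHaar p))
    (x : ℚ_[p]) (k : ℤ) :
    ∫ y in closedBall x ((p : ℝ) ^ (k + 1)), f y ∂padicHaar p =
      ∑ a : Fin p, ∫ y in closedBall (x + (a : ℕ) * (p : ℚ_[p]) ^ (-(k + 1))) ((p : ℝ) ^ k),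
        f y ∂padicHaar p := by
  rw [padic_closedBall_succ, integral_iUnion_fintype (fun _ => measurableSet_closedBall)
    (padic_closedBall_pairwise_disjoint x k) fun _ => hf.integrableOn_padic _ _]

theorem setIntegral_ballAvg_self [CompleteSpace E] (f : ℚ_[p] → E) (x : ℚ_[p]) (k : ℤ) :
    ∫ y in closedBall x ((p : ℝ) ^ k), ballAvg k f y ∂padicHaar p =
      ∫ y in closedBall x ((p : ℝ) ^ k), f y ∂padicHaar p := by
  rw [setIntegral_congr_fun (g := fun _ => ballAvg k f x) measurableSet_closedBall fun y hy =>
    ballAvg_eq_of_norm_sub_le f (by rwa [mem_closedBall, dist_eq_norm] at hy), setIntegral_const,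
    padicHaar_real_closedBall_zpow, ballAvg_eq, smul_inv_smul₀]
  exact (zpow_pos cast_prime_pos k).ne'

theorem setIntegral_ballAvg [CompleteSpace E] {f : ℚ_[p] → E}
    (hf : LocallyIntegrable f (padicHaar p)) {j i : ℤ} (hji : j ≤ i) (x : ℚ_[p]) :
    ∫ y in closedBall x ((p : ℝ) ^ i), ballAvg j f y ∂padicHaar p =
      ∫ y in closedBall x ((p : ℝ) ^ i), f y ∂padicHaar p := by
  induction i, hji using Int.leInduction generalizing x with
  | base => exact setIntegral_ballAvg_self f x j
  | succ i _ ih =>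
    rw [integral_padic_closedBall_succ hf, integral_padic_closedBall_succ
      (continuous_ballAvg j f).locallyIntegrable]
    exact Finset.sum_congr rfl fun a _ => ih _

/-- Averaging over small balls and then over large ones is averaging over the large ones. -/
theorem ballAvg_ballAvg [CompleteSpace E] {f : ℚ_[p] → E}
    (hf : LocallyIntegrable f (padicHaar p)) {j i : ℤ} (hji : j ≤ i) (x : ℚ_[p]) :
    ballAvg i (ballAvg j f) x = ballAvg i f x := by
  rw [ballAvg_eq, setIntegral_ballAvg hf hji, ← ballAvg_eq]

theorem enorm_ballAvg_mul_le (f : ℚ_[p] → E) (x : ℚ_[p]) (k : ℤ) :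
    ‖ballAvg k f x‖ₑ * padicHaar p (closedBall x ((p : ℝ) ^ k)) ≤
      ∫⁻ y in closedBall x ((p : ℝ) ^ k), ‖f y‖ₑ ∂padicHaar p := by
  rw [ballAvg, average_eq, enorm_smul, measureReal_restrict_apply_univ,
    Real.enorm_of_nonneg (by positivity), ENNReal.ofReal_inv_of_pos
      (by rw [padicHaar_real_closedBall_zpow]; exact zpow_pos cast_prime_pos k),
    ofReal_measureReal (padicHaar_closedBall_ne_top x _), mul_comm, ← mul_assoc,
    ENNReal.mul_inv_cancel (padicHaar_closedBall_ne_zero x k) (padicHaar_closedBall_ne_top x _),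
    one_mul]
  exact enorm_integral_le_lintegral_enorm _

/-- Averaging over balls of radius `p ^ j` does not increase the `L¹` norm on a larger ball. -/
theorem lintegral_enorm_ballAvg_le (f : ℚ_[p] → E) {j i : ℤ} (hji : j ≤ i) (x : ℚ_[p]) :
    ∫⁻ y in closedBall x ((p : ℝ) ^ i), ‖ballAvg j f y‖ₑ ∂padicHaar p ≤
      ∫⁻ y in closedBall x ((p : ℝ) ^ i), ‖f y‖ₑ ∂padicHaar p := by
  induction i, hji using Int.leInduction generalizing x with
  | base =>
    rw [setLIntegral_congr_fun (g := fun _ => ‖ballAvg j f x‖ₑ) measurableSet_closedBall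
      fun y hy => by
        simp only [ballAvg_eq_of_norm_sub_le f (by rwa [mem_closedBall, dist_eq_norm] at hy)],
      setLIntegral_const]
    exact enorm_ballAvg_mul_le f x j
  | succ i _ ih =>
    rw [lintegral_padic_closedBall_succ, lintegral_padic_closedBall_succ]
    exact Finset.sum_le_sum fun a _ => ih _

theorem ballAvg_const [CompleteSpace E] (k : ℤ) (c : E) (x : ℚ_[p]) :
    ballAvg k (fun _ => c) x = c :=
  setAverage_const (padicHaar_closedBall_ne_zero x k) (padicHaar_closedBall_ne_top x _) c

theorem ballAvg_sub (k : ℤ) {f g : ℚ_[p] → E} (hf : LocallyIntegrable f (padicHaar p))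
    (hg : LocallyIntegrable g (padicHaar p)) (x : ℚ_[p]) :
    ballAvg k (fun y => f y - g y) x = ballAvg k f x - ballAvg k g x := by
  simp only [ballAvg_eq]
  rw [integral_sub (hf.integrableOn_padic x _) (hg.integrableOn_padic x _), smul_sub]

end BallAvg

/-! ### Martingales converging everywhere to a locally integrable limit -/

/-- A family `G k` of functions, constant on balls of radius `p ^ k` and such that `G k` is the
average of `G (k - 1)`, is bounded above by the averages of its limit `h` as soon as it converges
to `h` at every point and `h` is locally integrable. -/
theorem le_ballAvg_of_tendsto {h : ℚ_[p] → ℝ} {G : ℤ → ℚ_[p] → ℝ}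
    (hh : LocallyIntegrable h (padicHaar p))
    (hconst : ∀ k x y, ‖x - y‖ ≤ (p : ℝ) ^ k → G k x = G k y)
    (havg : ∀ k x, ballAvg k (G (k - 1)) x = G k x)
    (hlim : ∀ x, Tendsto (fun k => G k x) atBot (𝓝 (h x))) (k : ℤ) (x : ℚ_[p]) :
    G k x ≤ ballAvg k h x := by
  have hpk : 0 < (p : ℝ) ^ k := zpow_pos cast_prime_pos k
  refine le_of_forall_pos_lt_add fun ε hε => ?_
  by_contra! hlt
  set B := closedBall x ((p : ℝ) ^ k) with hB
  have hint : Integrable (B.indicator h) (padicHaar p) :=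
    (integrable_indicator_iff measurableSet_closedBall).mpr (hh.integrableOn_padic _ _)
  -- a lower semicontinuous majorant `u > h` on `B` whose integral is nearly that of `h`
  obtain ⟨u, hu, hlsc, huint, hfin, hule⟩ := exists_lt_lowerSemicontinuous_integral_lt _ hint
    (mul_pos hε hpk)
  set v : ℚ_[p] → ℝ := fun y => (u y).toReal with hv
  have hvloc : LocallyIntegrable v (padicHaar p) := huint.locallyIntegrable
  have hGloc : ∀ j, LocallyIntegrable (G j) (padicHaar p) := fun j =>
    (continuous_of_eq_of_norm_sub_le (hconst j)).locallyIntegrable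
  set ψ : ℤ → ℚ_[p] → ℝ := fun j y => ballAvg j v y - G j y with hψ
  have hψconst : ∀ j y z, ‖y - z‖ ≤ (p : ℝ) ^ j → ψ j y = ψ j z := fun j y z hyz => by
    simp only [hψ, ballAvg_eq_of_norm_sub_le v hyz, hconst j y z hyz]
  have hψneg : ψ k x < 0 := by
    have h1 : ∫ y in B, v y ∂padicHaar p ≤ ∫ y, v y ∂padicHaar p := by
      rw [← integral_add_compl measurableSet_closedBall huint]
      refine le_add_of_nonneg_right (setIntegral_nonneg measurableSet_closedBall.compl ?_)
      intro y hy
      have := hu y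
      rw [Set.indicator_of_notMem hy] at this
      exact EReal.toReal_nonneg this.le
    have h2 : ballAvg k v x < ballAvg k h x + ε := by
      rw [integral_indicator measurableSet_closedBall] at hule
      have h3 := mul_lt_mul_of_pos_left (h1.trans_lt hule) (inv_pos.mpr hpk)
      rw [ballAvg_eq, ballAvg_eq, smul_eq_mul, smul_eq_mul]
      rwa [mul_add _ _ (ε * _), mul_comm ε, inv_mul_cancel_left₀ hpk.ne'] at h3
    simp only [hψ]
    linarith
  -- some point of each ball carries a value of `ψ` not above the average
  have hstep : ∀ j y, ∃ z ∈ closedBall y ((p : ℝ) ^ j), ψ (j - 1) z ≤ ψ j y := by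
    intro j y
    have h1 : LocallyIntegrable (ψ (j - 1)) (padicHaar p) :=
      (continuous_ballAvg (j - 1) v).locallyIntegrable.sub (hGloc (j - 1))
    obtain ⟨z, hz, hle⟩ := exists_le_setAverage (padicHaar_closedBall_ne_zero y j)
      (padicHaar_closedBall_ne_top y _) (h1.integrableOn_padic y _)
    refine ⟨z, hz, hle.trans_eq ?_⟩
    change ballAvg j (ψ (j - 1)) y = ψ j y
    simp only [hψ]
    rw [ballAvg_sub j (continuous_ballAvg (j - 1) v).locallyIntegrable (hGloc (j - 1)),
      ballAvg_ballAvg hvloc (by lia), havg]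
  choose next hnext hnextle using hstep
  let y : ℕ → ℚ_[p] := fun n => Nat.rec x (fun n z => next (k - n) z) n
  have hy : ∀ n, y (n + 1) = next (k - n) (y n) := fun n => rfl
  have hyneg : ∀ n : ℕ, ψ (k - n) (y n) < 0 := by
    intro n
    induction n with
    | zero => simpa [y] using hψneg
    | succ n ih =>
      rw [hy]
      refine lt_of_le_of_lt ?_ ih
      have := hnextle (k - n) (y n)
      rwa [show k - ((n + 1 : ℕ) : ℤ) = k - n - 1 by push_cast; ring]
  obtain ⟨z, hz⟩ : (⋂ n : ℕ, closedBall (y n) ((p : ℝ) ^ (k - n))).Nonempty := by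
    refine IsCompact.nonempty_iInter_of_sequence_nonempty_isCompact_isClosed _ (fun n => ?_)
      (fun n => ⟨y n, mem_closedBall_self (zpow_nonneg cast_prime_pos.le _)⟩)
      (isCompact_closedBall _ _) fun n => isClosed_closedBall
    have h1 := hnext (k - n) (y n)
    rw [← hy, mem_closedBall, dist_eq_norm] at h1
    rw [← padic_closedBall_eq h1]
    exact closedBall_subset_closedBall (zpow_le_zpow_right₀ one_lt_cast_prime.le (by lia))
  simp only [Set.mem_iInter, mem_closedBall, dist_eq_norm] at hz
  have hzneg : ∀ n : ℕ, ψ (k - n) z < 0 := fun n => (hψconst _ _ _ (hz n)).trans_lt (hyneg n)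
  -- but semicontinuity of `u` forces `ψ j z` to be positive for `j` near `-∞`
  have hzB : z ∈ B := by simpa [hB, dist_eq_norm, y] using hz 0
  have huz := hu z
  rw [Set.indicator_of_mem hzB] at huz
  obtain ⟨c, hhc, hcu⟩ := EReal.lt_iff_exists_real_btwn.mp huz
  obtain ⟨r, hr, hrc⟩ := Metric.eventually_nhds_iff_ball.mp (hlsc z c hcu)
  have hzpow : Tendsto (fun n : ℕ => (p : ℝ) ^ (k - n)) atTop (𝓝 0) := by
    have h1 := (tendsto_pow_atTop_nhds_zero_of_lt_one (inv_nonneg.mpr cast_prime_pos.le)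
      (inv_lt_one_of_one_lt₀ (one_lt_cast_prime (p := p)))).const_mul ((p : ℝ) ^ k)
    rw [mul_zero] at h1
    refine h1.congr fun n => ?_
    rw [zpow_sub₀ cast_prime_pos.ne', zpow_natCast, inv_pow, div_eq_mul_inv]
  have hG : Tendsto (fun n : ℕ => G (k - n) z) atTop (𝓝 (h z)) := by
    refine (hlim z).comp (tendsto_atBot.mpr fun b => ?_)
    filter_upwards [eventually_ge_atTop (k - b).toNat] with n hn
    lia
  obtain ⟨n, hn1, hn2⟩ := ((hzpow.eventually_lt_const hr).and
    (hG.eventually_lt_const (EReal.coe_lt_coe_iff.mp hhc))).exists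
  refine (hzneg n).not_gt (sub_pos.mpr (hn2.trans_le ?_))
  rw [← ballAvg_const (k - n) c z]
  simp only [ballAvg_eq, smul_eq_mul]
  refine mul_le_mul_of_nonneg_left ?_ (inv_nonneg.mpr (zpow_nonneg cast_prime_pos.le _))
  refine setIntegral_mono_on_ae (integrableOn_const (padicHaar_closedBall_ne_top _ _))
    huint.integrableOn measurableSet_closedBall ?_
  filter_upwards [hfin] with w hw hwz
  have h1 := hrc w (closedBall_subset_ball hn1 hwz)
  exact EReal.coe_le_coe_iff.mp (h1.le.trans (EReal.le_coe_toReal hw.ne))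

/-- A martingale on `ℚ_[p]` that converges **everywhere** to a locally integrable function `h` is
the family of averages of `h`. Convergence almost everywhere would not suffice: the densities of a
point mass converge to `0` at all other points. -/
theorem ballAvg_eq_of_tendsto {h : ℚ_[p] → ℝ} {G : ℤ → ℚ_[p] → ℝ}
    (hh : LocallyIntegrable h (padicHaar p))
    (hconst : ∀ k x y, ‖x - y‖ ≤ (p : ℝ) ^ k → G k x = G k y)
    (havg : ∀ k x, ballAvg k (G (k - 1)) x = G k x)
    (hlim : ∀ x, Tendsto (fun k => G k x) atBot (𝓝 (h x))) (k : ℤ) (x : ℚ_[p]) :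
    ballAvg k h x = G k x := by
  refine le_antisymm ?_ (le_ballAvg_of_tendsto hh hconst havg hlim k x)
  have hneg : ∀ (j : ℤ) (f : ℚ_[p] → ℝ) (y : ℚ_[p]),
      ballAvg j (fun z => -f z) y = -ballAvg j f y := fun j f y => by
    rw [ballAvg_eq, ballAvg_eq, integral_neg, smul_neg]
  have := le_ballAvg_of_tendsto (h := fun y => -h y) (G := fun j y => -G j y) hh.neg
    (fun j y z hyz => by rw [hconst j y z hyz]) (fun j y => by rw [hneg, havg])
    (fun y => (hlim y).neg) k x
  rw [hneg] at this
  linarith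

theorem ballAvg_eq_of_tendsto_complex {h : ℚ_[p] → ℂ} {G : ℤ → ℚ_[p] → ℂ}
    (hh : LocallyIntegrable h (padicHaar p))
    (hconst : ∀ k x y, ‖x - y‖ ≤ (p : ℝ) ^ k → G k x = G k y)
    (havg : ∀ k x, ballAvg k (G (k - 1)) x = G k x)
    (hlim : ∀ x, Tendsto (fun k => G k x) atBot (𝓝 (h x))) (k : ℤ) (x : ℚ_[p]) :
    ballAvg k h x = G k x := by
  have hcomp : ∀ (L : ℂ →L[ℝ] ℝ), L (ballAvg k h x) = L (G k x) := by
    intro L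
    have hL : ∀ (j : ℤ) {f : ℚ_[p] → ℂ} (_ : LocallyIntegrable f (padicHaar p)) (y : ℚ_[p]),
        ballAvg j (fun z => L (f z)) y = L (ballAvg j f y) := fun j f hf y => by
      rw [ballAvg_eq, ballAvg_eq, L.map_smul, L.integral_comp_comm (hf.integrableOn_padic _ _)]
    have hLh : LocallyIntegrable (fun z => L (h z)) (padicHaar p) := fun y => by
      obtain ⟨s, hs, hi⟩ := hh y
      exact ⟨s, hs, L.integrable_comp hi⟩
    rw [← hL k hh]
    refine ballAvg_eq_of_tendsto hLh (G := fun j y => L (G j y))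
      (fun j y z hyz => by rw [hconst j y z hyz]) (fun j y => ?_)
      (fun y => (L.continuous.tendsto _).comp (hlim y)) k x
    rw [hL j (continuous_of_eq_of_norm_sub_le (hconst (j - 1))).locallyIntegrable, havg]
  exact Complex.ext (hcomp Complex.reCLM) (hcomp Complex.imCLM)

/-! ### Weighted sums over scales -/

theorem tsum_int_tsum_nat_mul_sub (g : ℕ → ℝ≥0∞) (F : ℤ → ℝ≥0∞) :
    ∑' i : ℤ, ∑' n : ℕ, g n * F (i - n) = (∑' n, g n) * ∑' i, F i := by
  rw [ENNReal.tsum_comm, ← ENNReal.tsum_mul_right]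
  refine tsum_congr fun n => ?_
  rw [ENNReal.tsum_mul_left]
  congr 1
  exact (Equiv.subRight (n : ℤ)).tsum_eq F

theorem prime_rpow_add (a b : ℝ) : (p : ℝ≥0∞) ^ (a + b) = (p : ℝ≥0∞) ^ a * (p : ℝ≥0∞) ^ b :=
  ENNReal.rpow_add _ _ (mod_cast hp.out.ne_zero) (ENNReal.natCast_ne_top p)

theorem prime_rpow_ne_top (a : ℝ) : (p : ℝ≥0∞) ^ a ≠ ∞ :=
  ENNReal.rpow_ne_top_of_ne_zero (mod_cast hp.out.ne_zero) (ENNReal.natCast_ne_top p)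

theorem prime_rpow_ne_zero (a : ℝ) : (p : ℝ≥0∞) ^ a ≠ 0 := by
  simp [ENNReal.rpow_eq_zero_iff, hp.out.ne_zero]

theorem ofReal_prime_rpow (a : ℝ) : ENNReal.ofReal ((p : ℝ) ^ a) = (p : ℝ≥0∞) ^ a := by
  rw [← ENNReal.ofReal_rpow_of_pos cast_prime_pos, ENNReal.ofReal_natCast]

theorem tsum_prime_rpow_neg_ne_top {γ : ℝ} (hγ : 0 < γ) :
    ∑' n : ℕ, (p : ℝ≥0∞) ^ (-(n * γ)) ≠ ∞ := by
  have h : ∀ n : ℕ, (p : ℝ≥0∞) ^ (-(n * γ)) = ((p : ℝ≥0∞) ^ (-γ)) ^ n := fun n => by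
    rw [← ENNReal.rpow_mul_natCast]; congr 1; ring
  simp_rw [h]
  rw [ENNReal.tsum_geometric, ENNReal.inv_ne_top]
  refine (tsub_pos_of_lt ?_).ne'
  exact ENNReal.rpow_lt_one_of_one_lt_of_neg (mod_cast hp.out.one_lt) (neg_lt_zero.mpr hγ)

/-- The discrete Hardy inequality in `ℓ¹`: weighted summability passes from a sequence to its
partial sums. -/
theorem tsum_prime_rpow_mul_tsum_ne_top {γ : ℝ} (hγ : 0 < γ) {a : ℤ → ℝ≥0∞}
    (ha : ∑' j : ℤ, (p : ℝ≥0∞) ^ (-(j * γ)) * a j ≠ ∞) :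
    ∑' j : ℤ, (p : ℝ≥0∞) ^ (-(j * γ)) * ∑' n : ℕ, a (j - n) ≠ ∞ := by
  have h : ∀ (j : ℤ) (n : ℕ), (p : ℝ≥0∞) ^ (-(j * γ)) * a (j - n) =
      (p : ℝ≥0∞) ^ (-(n * γ)) * ((p : ℝ≥0∞) ^ (-((j - n : ℤ) * γ)) * a (j - n)) := fun j n => by
    rw [← mul_assoc, ← prime_rpow_add]; push_cast; ring_nf
  simp_rw [← ENNReal.tsum_mul_left, h]
  rw [tsum_int_tsum_nat_mul_sub _ fun j : ℤ => (p : ℝ≥0∞) ^ (-(j * γ)) * a j]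
  exact ENNReal.mul_ne_top (tsum_prime_rpow_neg_ne_top hγ) ha

theorem HasSum.of_forall_eq {ι : Type*} {f g : ι → ℂ} {a : ℂ} (hg : HasSum g a)
    (h : ∀ i, f i = g i) : HasSum f a :=
  funext h ▸ hg

/-! ### The Vladimirov operator as a multiplier on the scales -/

theorem vladimirovIntegrand_of_mem_sphere {α : ℝ} {f : ℚ_[p] → ℂ} {x y : ℚ_[p]} {k : ℤ}
    (hy : y ∈ sphere x ((p : ℝ) ^ k)) :
    vladimirovIntegrand p α f x y = (p : ℝ) ^ (-(k * (α + 1))) • (f x - f y) := by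
  rw [mem_sphere, dist_eq_norm, norm_sub_rev] at hy
  rw [vladimirovIntegrand, hy, ← Real.rpow_intCast, ← Real.rpow_mul cast_prime_pos.le,
    Real.rpow_neg cast_prime_pos.le, Complex.real_smul, Complex.ofReal_inv, div_eq_inv_mul]

/-- The absolute integral for `D^α f (x)`, sphere by sphere about `x`. -/
theorem lintegral_enorm_vladimirovIntegrand (α : ℝ) (f : ℚ_[p] → ℂ) (x : ℚ_[p]) :
    ∫⁻ y, ‖vladimirovIntegrand p α f x y‖ₑ ∂padicHaar p =
      ∑' k : ℤ, (p : ℝ≥0∞) ^ (-(k * (α + 1))) *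
        ∫⁻ y in sphere x ((p : ℝ) ^ k), ‖f x - f y‖ₑ ∂padicHaar p := by
  rw [lintegral_eq_tsum_padic_sphere _ x]
  refine tsum_congr fun k => ?_
  rw [← lintegral_const_mul' _ _ (prime_rpow_ne_top _)]
  refine setLIntegral_congr_fun isClosed_sphere.measurableSet fun y hy => ?_
  simp only [vladimirovIntegrand_of_mem_sphere hy, enorm_smul]
  rw [Real.enorm_of_nonneg (Real.rpow_nonneg cast_prime_pos.le _), ofReal_prime_rpow]

/-- Convergence of the integral for `D^α f (x)` controls the oscillation of `f` on balls about `x`,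
not only on spheres. -/
theorem VladimirovDefinedAt.tsum_closedBall_ne_top {α : ℝ} (hα : 0 < α) {f : ℚ_[p] → ℂ}
    {x : ℚ_[p]} (hf : VladimirovDefinedAt p α f x) :
    ∑' k : ℤ, (p : ℝ≥0∞) ^ (-(k * (α + 1))) *
      ∫⁻ y in closedBall x ((p : ℝ) ^ k), ‖f x - f y‖ₑ ∂padicHaar p ≠ ∞ := by
  simp_rw [lintegral_padic_closedBall_eq_tsum]
  refine tsum_prime_rpow_mul_tsum_ne_top (by linarith)
    (a := fun k => ∫⁻ y in sphere x ((p : ℝ) ^ k), ‖f x - f y‖ₑ ∂padicHaar p) ?_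
  rw [← lintegral_enorm_vladimirovIntegrand]
  exact hf.2.ne

theorem VladimirovDefinedAt.aestronglyMeasurable {α : ℝ} {f : ℚ_[p] → ℂ} {x : ℚ_[p]}
    (hf : VladimirovDefinedAt p α f x) :
    AEStronglyMeasurable (fun y => f x - f y) (padicHaar p) := by
  have h1 : Measurable fun y : ℚ_[p] => ((‖x - y‖ ^ (α + 1) : ℝ) : ℂ) := by fun_prop
  refine (hf.1.mul h1.aestronglyMeasurable).congr ?_
  filter_upwards [compl_mem_ae_iff.mpr (measure_singleton x)] with y hy
  have h2 : 0 < ‖x - y‖ := norm_pos_iff.mpr (sub_ne_zero.mpr (Ne.symm hy))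
  exact div_mul_cancel₀ _ (Complex.ofReal_ne_zero.mpr (Real.rpow_pos_of_pos h2 _).ne')

theorem exists_mem_padic_ball (x y : ℚ_[p]) : ∃ k : ℤ, y ∈ ball x ((p : ℝ) ^ k) := by
  obtain ⟨n, hn⟩ := pow_unbounded_of_one_lt (dist y x) (one_lt_cast_prime (p := p))
  exact ⟨n, by simpa using hn⟩

/-- Convergence of the integral at a single point makes `f` locally integrable everywhere, because
the kernel is bounded below on every ball about that point. -/
theorem VladimirovDefinedAt.locallyIntegrable {α : ℝ} (hα : 0 < α) {f : ℚ_[p] → ℂ}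
    {x : ℚ_[p]} (hf : VladimirovDefinedAt p α f x) :
    LocallyIntegrable f (padicHaar p) := by
  have h1 : LocallyIntegrable (fun y => f x - f y) (padicHaar p) := by
    intro y
    obtain ⟨k, hk⟩ := exists_mem_padic_ball x y
    refine ⟨_, mem_of_superset (isOpen_ball.mem_nhds hk) ball_subset_closedBall,
      hf.aestronglyMeasurable.restrict, ?_⟩
    have h2 := ENNReal.ne_top_of_tsum_ne_top (hf.tsum_closedBall_ne_top hα) k
    exact ENNReal.lt_top_of_mul_ne_top_right h2 (prime_rpow_ne_zero _)
  have h2 : (fun _ => f x) - (fun y => f x - f y) = f := by ext y; simp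
  exact h2 ▸ (locallyIntegrable_const (f x)).sub h1

/-- The martingale difference of `f` at `x` between the balls of radius `p ^ (k - 1)` and
`p ^ k`. -/
noncomputable def ballDiff (k : ℤ) (f : ℚ_[p] → ℂ) (x : ℚ_[p]) : ℂ :=
  ballAvg (k - 1) f x - ballAvg k f x

theorem sub_ballAvg_eq {f : ℚ_[p] → ℂ} (hf : LocallyIntegrable f (padicHaar p)) (x : ℚ_[p])
    (k : ℤ) : f x - ballAvg k f x =
      ((p : ℝ) ^ k)⁻¹ • ∫ y in closedBall x ((p : ℝ) ^ k), (f x - f y) ∂padicHaar p := by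
  rw [← ballAvg_eq, ballAvg_sub k (locallyIntegrable_const _) hf, ballAvg_const]

/-- The oscillation of `f` about `x` on balls, weighted as in the integral for `D^α`, is summable
over the scales. -/
theorem VladimirovDefinedAt.summable_sub_ballAvg {α : ℝ} (hα : 0 < α) {f : ℚ_[p] → ℂ} {x : ℚ_[p]}
    (hf : VladimirovDefinedAt p α f x) :
    Summable fun k : ℤ => (p : ℝ) ^ (-(k * α)) • (f x - ballAvg k f x) := by
  refine (tsum_enorm_ne_top_iff_summable_norm.mp (ne_top_of_le_ne_top
    (hf.tsum_closedBall_ne_top hα) (ENNReal.tsum_le_tsum fun k => ?_))).of_norm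
  rw [sub_ballAvg_eq (hf.locallyIntegrable hα), smul_smul, ← Real.rpow_intCast,
    ← Real.rpow_neg cast_prime_pos.le, ← Real.rpow_add cast_prime_pos, enorm_smul,
    Real.enorm_of_nonneg (Real.rpow_nonneg cast_prime_pos.le _), ofReal_prime_rpow,
    show -((k : ℝ) * α) + -k = -(k * (α + 1)) by ring]
  gcongr
  exact enorm_integral_le_lintegral_enorm _

theorem VladimirovDefinedAt.tendsto_ballAvg {α : ℝ} (hα : 0 < α) {f : ℚ_[p] → ℂ} {x : ℚ_[p]}
    (hf : VladimirovDefinedAt p α f x) :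
    Tendsto (fun n : ℕ => ballAvg (-n : ℤ) f x) atTop (𝓝 (f x)) := by
  have h1 := (hf.summable_sub_ballAvg hα).comp_injective (i := fun n : ℕ => (-n : ℤ))
    (neg_injective.comp Nat.cast_injective)
  have h2 : Tendsto (fun n : ℕ => f x - ballAvg (-n : ℤ) f x) atTop (𝓝 0) := by
    refine squeeze_zero_norm (fun n => ?_) (tendsto_zero_iff_norm_tendsto_zero.mp
      h1.tendsto_atTop_zero)
    simp only [Function.comp_apply, norm_smul]
    refine le_mul_of_one_le_left (norm_nonneg _) ?_
    rw [Real.norm_of_nonneg (Real.rpow_nonneg cast_prime_pos.le _)]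
    refine Real.one_le_rpow one_lt_cast_prime.le ?_
    push_cast
    rw [neg_mul, neg_neg]
    positivity
  simpa using h2.const_sub (f x)

/-- `D^α` multiplies the martingale difference at scale `p ^ k` by `p ^ (α (1 - k))`. -/
theorem VladimirovDefinedAt.hasSum {α : ℝ} (hα : 0 < α) {f : ℚ_[p] → ℂ} {x : ℚ_[p]}
    (hf : VladimirovDefinedAt p α f x) :
    HasSum (fun k : ℤ => (p : ℝ) ^ (α * (1 - k)) • ballDiff k f x) (vladimirov p α f x) := by
  have hp0 := cast_prime_pos (p := p)
  have hloc := hf.locallyIntegrable hα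
  obtain ⟨S, hS⟩ := hf.summable_sub_ballAvg hα
  have hS' := (Equiv.subRight (1 : ℤ)).hasSum_iff.mpr hS
  simp only [Function.comp_def, Equiv.subRight_apply] at hS'
  have hball : ∀ k : ℤ, ∫ y in closedBall x ((p : ℝ) ^ k), (f x - f y) ∂padicHaar p =
      (p : ℝ) ^ (k : ℝ) • (f x - ballAvg k f x) := fun k => by
    rw [sub_ballAvg_eq hloc, Real.rpow_intCast, smul_inv_smul₀ (zpow_pos hp0 k).ne']
  have hsphere : ∀ k : ℤ, ∫ y in sphere x ((p : ℝ) ^ k), (f x - f y) ∂padicHaar p =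
      (p : ℝ) ^ (k : ℝ) • (f x - ballAvg k f x) -
        (p : ℝ) ^ ((k - 1 : ℤ) : ℝ) • (f x - ballAvg (k - 1) f x) := fun k => by
    have hint : IntegrableOn (fun y => f x - f y) (closedBall x ((p : ℝ) ^ k)) (padicHaar p) :=
      ((locallyIntegrable_const (f x)).sub hloc).integrableOn_padic x _
    rw [← hball, ← hball, eq_sub_iff_add_eq, padic_closedBall_eq_union x k,
      setIntegral_union (padic_sphere_disjoint_closedBall x k) measurableSet_closedBall
        (hint.mono_set sphere_subset_closedBall) (hint.mono_set (closedBall_subset_closedBall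
          (zpow_le_zpow_right₀ one_lt_cast_prime.le (by lia))))]
  have hI : ∫ y, vladimirovIntegrand p α f x y ∂padicHaar p =
      S - (p : ℝ) ^ (-(α + 1)) • S := by
    refine (hasSum_integral_padic_sphere hf x).unique ?_
    refine (hS.sub (hS'.const_smul ((p : ℝ) ^ (-(α + 1))))).of_forall_eq fun k => ?_
    rw [setIntegral_congr_fun isClosed_sphere.measurableSet fun y hy =>
      vladimirovIntegrand_of_mem_sphere hy, integral_smul, hsphere, smul_sub, smul_smul, smul_smul,
      smul_smul, ← Real.rpow_add hp0, ← Real.rpow_add hp0, ← Real.rpow_add hp0]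
    push_cast
    ring_nf
  have hvalue : vladimirov p α f x = (p : ℝ) ^ α • (S - (p : ℝ) ^ (-α) • S) := by
    have h1 : (1 : ℝ) - (p : ℝ) ^ (-α - 1) ≠ 0 :=
      (sub_pos.mpr (Real.rpow_lt_one_of_one_lt_of_neg one_lt_cast_prime (by linarith))).ne'
    have h2 : (p : ℝ) ^ α * (p : ℝ) ^ (-α) = 1 := by
      rw [← Real.rpow_add hp0, add_neg_cancel, Real.rpow_zero]
    have h3 : ∀ c : ℝ, S - c • S = (1 - c) • S := fun c => by rw [sub_smul, one_smul]
    rw [vladimirov, hI, ← Complex.real_smul, show -(α + 1) = -α - 1 by ring, h3, h3,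
      smul_smul, div_mul_cancel₀ _ h1, smul_smul, mul_sub, mul_one, h2]
  rw [hvalue]
  refine ((hS.sub (hS'.const_smul ((p : ℝ) ^ (-α)))).const_smul ((p : ℝ) ^ α)).of_forall_eq
    fun k => ?_
  rw [smul_sub, smul_smul, smul_smul, smul_smul, ← Real.rpow_add hp0, ← Real.rpow_add hp0,
    ← Real.rpow_add hp0, ballDiff, ← sub_sub_sub_cancel_left _ _ (f x), smul_sub]
  push_cast
  ring_nf

/-! ### Martingale differences of `D^α f` -/

theorem Int.map_neg_natCast_atTop : map (fun n : ℕ => (-n : ℤ)) atTop = atBot := by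
  rw [← map_neg_atTop, ← Nat.map_cast_int_atTop, map_map]; rfl

theorem ballAvg_of_forall_eq {g : ℚ_[p] → ℂ} {k : ℤ} {x : ℚ_[p]}
    (hg : ∀ y, ‖x - y‖ ≤ (p : ℝ) ^ k → g x = g y) : ballAvg k g x = g x := by
  rw [← ballAvg_const k (g x) x, ballAvg_eq, ballAvg_eq]
  congr 1
  refine setIntegral_congr_fun measurableSet_closedBall fun y hy => (hg y ?_).symm
  rwa [mem_closedBall, dist_eq_norm, norm_sub_rev] at hy

theorem ballDiff_eq_of_norm_sub_le (f : ℚ_[p] → ℂ) {k : ℤ} {x y : ℚ_[p]}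
    (h : ‖x - y‖ ≤ (p : ℝ) ^ (k - 1)) : ballDiff k f x = ballDiff k f y := by
  rw [ballDiff, ballDiff, ballAvg_eq_of_norm_sub_le f h, ballAvg_eq_of_norm_sub_le f
    (h.trans (zpow_le_zpow_right₀ one_lt_cast_prime.le (by lia)))]

theorem ballAvg_ballDiff {f : ℚ_[p] → ℂ} (hf : LocallyIntegrable f (padicHaar p)) (k : ℤ)
    (x : ℚ_[p]) : ballAvg k (ballDiff k f) x = 0 := by
  change ballAvg k (fun y => ballAvg (k - 1) f y - ballAvg k f y) x = 0
  rw [ballAvg_sub k (continuous_ballAvg _ f).locallyIntegrable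
    (continuous_ballAvg _ f).locallyIntegrable, ballAvg_ballAvg hf (by lia),
    ballAvg_ballAvg hf le_rfl, sub_self]

/-- If `D^α f` is defined everywhere and locally integrable, its martingale differences are those
of `f`, multiplied by `p ^ (α (1 - k))`. The double integral behind `ballAvg k (D^α f)` need not
converge absolutely, so this rests on the convergence of the partial sums at every point. -/
theorem ballDiff_vladimirov {α : ℝ} (hα : 0 < α) {f : ℚ_[p] → ℂ}
    (hf : ∀ y, VladimirovDefinedAt p α f y)
    (hloc : LocallyIntegrable (vladimirov p α f) (padicHaar p)) (k : ℤ) (x : ℚ_[p]) :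
    ballDiff k (vladimirov p α f) x = (p : ℝ) ^ (α * (1 - k)) • ballDiff k f x := by
  have hfloc := (hf 0).locallyIntegrable hα
  set t : ℤ → ℚ_[p] → ℂ := fun k y => (p : ℝ) ^ (α * (1 - k)) • ballDiff k f y with ht
  have hsum : ∀ y, HasSum (fun k => t k y) (vladimirov p α f y) := fun y => (hf y).hasSum hα
  set G : ℤ → ℚ_[p] → ℂ := fun k y => ∑' n : ℕ, t (k + 1 + n) y with hG
  have hsummable : ∀ k y, Summable fun n : ℕ => t (k + 1 + n) y := fun k y =>
    (hsum y).summable.comp_injective ((add_right_injective _).comp Nat.cast_injective)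
  have hGstep : ∀ k y, G (k - 1) y = t k y + G k y := by
    intro k y
    simp only [hG]
    rw [(hsummable (k - 1) y).tsum_eq_zero_add]
    push_cast
    simp only [sub_add_cancel, add_zero]
    congr 1
    exact tsum_congr fun n => by ring_nf
  have hconst : ∀ k y z, ‖y - z‖ ≤ (p : ℝ) ^ k → G k y = G k z := by
    intro k y z hyz
    refine tsum_congr fun n => ?_
    simp only [ht]
    rw [ballDiff_eq_of_norm_sub_le f (hyz.trans (zpow_le_zpow_right₀ one_lt_cast_prime.le
      (by lia)))]
  have havg : ∀ k y, ballAvg k (G (k - 1)) y = G k y := by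
    intro k y
    have h1 : G k = fun z => G (k - 1) z - t k z := by ext z; rw [hGstep]; ring
    have h2 : ballAvg k (t k) y = 0 := by
      have := ballAvg_ballDiff hfloc k y
      rw [ballAvg_eq] at this ⊢
      rw [integral_smul, smul_comm, this, smul_zero]
    have h3 : LocallyIntegrable (t k) (padicHaar p) :=
      (continuous_of_eq_of_norm_sub_le (k := k - 1) fun z w hzw => by
        simp only [ht, ballDiff_eq_of_norm_sub_le f hzw]).locallyIntegrable
    have h4 := ballAvg_of_forall_eq (hconst k y)
    rwa [h1, ballAvg_sub k (continuous_of_eq_of_norm_sub_le (hconst _)).locallyIntegrable h3, h2,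
      sub_zero, ← h1] at h4
  clear_value t
  have hlim : ∀ y, Tendsto (fun k => G k y) atBot (𝓝 (vladimirov p α f y)) := by
    intro y
    rw [← Int.map_neg_natCast_atTop, tendsto_map'_iff]
    have h1 := (tendsto_sum_nat_add fun n : ℕ => t (-n) y).const_sub (vladimirov p α f y)
    rw [sub_zero] at h1
    refine h1.congr fun m => ?_
    have h2 : Summable fun n : ℕ => t (-(n + m : ℕ)) y :=
      (hsum y).summable.comp_injective (i := fun n : ℕ => (-(n + m : ℕ) : ℤ)) fun a b hab => by
        simpa using hab
    have h3 : HasSum (fun j : ℤ => t (-m + 1 + j) y) (vladimirov p α f y) :=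
      (Equiv.addLeft (-(m : ℤ) + 1)).hasSum_iff.mpr (hsum y)
    have h4 : HasSum (fun n : ℕ => t (-m + 1 + (n : ℤ)) y) (G (-m) y) :=
      (hsummable (-m) y).hasSum
    have h5 : HasSum (fun n : ℕ => t (-m + 1 + -((n : ℤ) + 1)) y)
        (∑' n : ℕ, t (-(n + m : ℕ)) y) :=
      h2.hasSum.of_forall_eq fun n => by
        rw [show -(m : ℤ) + 1 + -((n : ℤ) + 1) = -(n + m : ℕ) by push_cast; ring]
    rw [h3.unique (HasSum.of_nat_of_neg_add_one (f := fun j : ℤ => t (-m + 1 + j) y) h4 h5),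
      add_sub_cancel_right]
    rfl
  have hmain := fun k => ballAvg_eq_of_tendsto_complex hloc hconst havg hlim k x
  rw [ballDiff, hmain, hmain, hGstep, add_sub_cancel_right, ht]

/-! ### The semigroup law -/

theorem tendsto_sum_range_ballDiff {f : ℚ_[p] → ℂ} {x : ℚ_[p]}
    (h : Tendsto (fun n : ℕ => ballAvg (-n : ℤ) f x) atTop (𝓝 (f x))) (i : ℤ) :
    Tendsto (fun N => ∑ n ∈ Finset.range N, ballDiff (i - n) f x) atTop
      (𝓝 (f x - ballAvg i f x)) := by
  have h1 : ∀ N : ℕ, ∑ n ∈ Finset.range N, ballDiff (i - n) f x =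
      ballAvg (i - N) f x - ballAvg i f x := fun N => by
    induction N with
    | zero => simp
    | succ N ih =>
      rw [Finset.sum_range_succ, ih, ballDiff]
      push_cast
      rw [← sub_sub]; ring
  simp_rw [h1]
  refine Tendsto.sub_const ?_ _
  have h2 : Tendsto (fun k : ℤ => ballAvg k f x) atBot (𝓝 (f x)) := by
    rwa [← Int.map_neg_natCast_atTop, tendsto_map'_iff]
  refine h2.comp (tendsto_atBot.mpr fun b => ?_)
  filter_upwards [eventually_ge_atTop (i - b).toNat] with n hn
  lia

/-- Telescoping over the scales below `p ^ i`, at a point where the averages of `f` converge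
to `f`. -/
theorem enorm_sub_ballAvg_le_tsum {f : ℚ_[p] → ℂ} {x : ℚ_[p]}
    (h : Tendsto (fun n : ℕ => ballAvg (-n : ℤ) f x) atTop (𝓝 (f x))) (i : ℤ) :
    ‖f x - ballAvg i f x‖ₑ ≤ ∑' n : ℕ, ‖ballDiff (i - n) f x‖ₑ := by
  refine le_of_tendsto (tendsto_sum_range_ballDiff h i).enorm (Eventually.of_forall fun N => ?_)
  exact (enorm_sum_le _ _).trans (ENNReal.sum_le_tsum _)

/-- The `L¹` norm of a martingale difference of `h` on a ball about `x` is controlled by the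
oscillation of `h` about `x`. -/
theorem lintegral_enorm_ballDiff_le {h : ℚ_[p] → ℂ} (hloc : LocallyIntegrable h (padicHaar p))
    (x : ℚ_[p]) {j i : ℤ} (hji : j ≤ i) :
    ∫⁻ y in closedBall x ((p : ℝ) ^ i), ‖ballDiff j h y‖ₑ ∂padicHaar p ≤
      2 * ∫⁻ y in closedBall x ((p : ℝ) ^ i), ‖h x - h y‖ₑ ∂padicHaar p := by
  have h1 : ∀ y, ballDiff j h y = ballAvg j (fun z => h x - h z) y -
      ballAvg (j - 1) (fun z => h x - h z) y := fun y => by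
    rw [ballAvg_sub j (locallyIntegrable_const _) hloc,
      ballAvg_sub (j - 1) (locallyIntegrable_const _) hloc, ballAvg_const, ballAvg_const, ballDiff]
    ring
  calc _ ≤ ∫⁻ y in closedBall x ((p : ℝ) ^ i), (‖ballAvg j (fun z => h x - h z) y‖ₑ +
        ‖ballAvg (j - 1) (fun z => h x - h z) y‖ₑ) ∂padicHaar p :=
        lintegral_mono fun y => by rw [h1]; exact enorm_sub_le
    _ = _ := lintegral_add_left (continuous_ballAvg _ _).enorm.measurable _
    _ ≤ _ := by
      rw [two_mul]
      exact add_le_add (lintegral_enorm_ballAvg_le _ hji x)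
        (lintegral_enorm_ballAvg_le _ (by lia) x)

theorem enorm_ballDiff_le {h : ℚ_[p] → ℂ} (hloc : LocallyIntegrable h (padicHaar p))
    (x : ℚ_[p]) (j : ℤ) :
    ‖ballDiff j h x‖ₑ ≤ (p : ℝ≥0∞) ^ (1 - j : ℝ) *
      (2 * ∫⁻ y in closedBall x ((p : ℝ) ^ j), ‖h x - h y‖ₑ ∂padicHaar p) := by
  have h1 : ‖ballDiff j h x‖ₑ * (p : ℝ≥0∞) ^ (j - 1 : ℝ) ≤
      2 * ∫⁻ y in closedBall x ((p : ℝ) ^ j), ‖h x - h y‖ₑ ∂padicHaar p := by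
    refine le_trans ?_ (lintegral_enorm_ballDiff_le hloc x le_rfl)
    calc _ = ∫⁻ y in closedBall x ((p : ℝ) ^ (j - 1)), ‖ballDiff j h y‖ₑ ∂padicHaar p := by
          rw [setLIntegral_congr_fun (g := fun _ => ‖ballDiff j h x‖ₑ) measurableSet_closedBall
            fun y hy => by
              simp only [ballDiff_eq_of_norm_sub_le h
                (by rwa [mem_closedBall, dist_eq_norm] at hy)],
            setLIntegral_const, padicHaar_closedBall_zpow, ← ENNReal.rpow_intCast]
          push_cast; rfl
      _ ≤ _ := lintegral_mono_set (closedBall_subset_closedBall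
          (zpow_le_zpow_right₀ one_lt_cast_prime.le (by lia)))
  calc ‖ballDiff j h x‖ₑ = (p : ℝ≥0∞) ^ (1 - j : ℝ) *
        (‖ballDiff j h x‖ₑ * (p : ℝ≥0∞) ^ (j - 1 : ℝ)) := by
        rw [mul_left_comm, ← prime_rpow_add]; simp
    _ ≤ _ := by gcongr

/-- If `D^β f` is everywhere defined, then the integral for `D^(α+β) f (x)` converges as soon as
that for `D^α (D^β f) (x)` does. -/
theorem VladimirovDefinedAt.add {α β : ℝ} (hα : 0 < α) (hβ : 0 < β) {f : ℚ_[p] → ℂ} {x : ℚ_[p]}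
    (hf : ∀ y, VladimirovDefinedAt p β f y)
    (hx : VladimirovDefinedAt p α (vladimirov p β f) x) :
    VladimirovDefinedAt p (α + β) f x := by
  set h := vladimirov p β f with hh
  have hloc := hx.locallyIntegrable hα
  have hfloc := (hf x).locallyIntegrable hβ
  set A : ℤ → ℝ≥0∞ := fun i =>
    ∫⁻ y in closedBall x ((p : ℝ) ^ i), ‖h x - h y‖ₑ ∂padicHaar p with hA
  have hAsum : ∑' i : ℤ, (p : ℝ≥0∞) ^ (-(i * (α + 1))) * A i ≠ ∞ := hx.tsum_closedBall_ne_top hα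
  -- `f` is recovered from `h` by dividing the martingale differences by their multipliers
  have hdiff : ∀ j y, ‖ballDiff j f y‖ₑ = (p : ℝ≥0∞) ^ (β * (j - 1)) * ‖ballDiff j h y‖ₑ := by
    intro j y
    rw [hh, ballDiff_vladimirov hβ hf hloc, enorm_smul,
      Real.enorm_of_nonneg (Real.rpow_nonneg cast_prime_pos.le _), ofReal_prime_rpow, ← mul_assoc,
      ← prime_rpow_add, ← mul_add, sub_add_sub_cancel]
    simp
  have hosc : ∀ i y, ‖f y - ballAvg i f y‖ₑ ≤
      ∑' n : ℕ, (p : ℝ≥0∞) ^ (β * (i - n - 1)) * ‖ballDiff (i - n) h y‖ₑ := by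
    intro i y
    refine (enorm_sub_ballAvg_le_tsum ((hf y).tendsto_ballAvg hβ) i).trans_eq ?_
    refine tsum_congr fun n => ?_
    rw [hdiff]
    push_cast; rfl
  have hcont : ∀ j, Continuous (ballDiff j h) := fun j =>
    (continuous_ballAvg _ h).sub (continuous_ballAvg _ h)
  have hfmeas : AEStronglyMeasurable f (padicHaar p) := hfloc.aestronglyMeasurable
  refine ⟨?_, ?_⟩
  · exact (aestronglyMeasurable_const.sub hfmeas).div₀ (by
      refine Measurable.aestronglyMeasurable ?_; fun_prop)
  rw [hasFiniteIntegral_iff_enorm, lintegral_enorm_vladimirovIntegrand]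
  -- on the sphere of radius `p ^ i`, `f x` and `f y` have the same average over `p ^ i`-balls
  have hbound : ∀ i : ℤ, ∫⁻ y in sphere x ((p : ℝ) ^ i), ‖f x - f y‖ₑ ∂padicHaar p ≤
      (p : ℝ≥0∞) ^ (i : ℝ) * ∑' n : ℕ, (p : ℝ≥0∞) ^ (β * (i - n - 1)) *
        ((p : ℝ≥0∞) ^ (1 - (i - n) : ℝ) * (2 * A (i - n))) +
      ∑' n : ℕ, (p : ℝ≥0∞) ^ (β * (i - n - 1)) * (2 * A i) := by
    intro i
    calc _ ≤ ∫⁻ y in sphere x ((p : ℝ) ^ i), (‖f x - ballAvg i f x‖ₑ +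
          ∑' n : ℕ, (p : ℝ≥0∞) ^ (β * (i - n - 1)) * ‖ballDiff (i - n) h y‖ₑ) ∂padicHaar p := by
          refine setLIntegral_mono' isClosed_sphere.measurableSet fun y hy => ?_
          rw [mem_sphere, dist_eq_norm] at hy
          have h1 : f x - f y = (f x - ballAvg i f x) - (f y - ballAvg i f y) := by
            rw [ballAvg_eq_of_norm_sub_le f hy.le]; ring
          rw [h1]
          exact enorm_sub_le.trans (add_le_add_right (hosc i y) _)
      _ ≤ ∫⁻ y in closedBall x ((p : ℝ) ^ i), (‖f x - ballAvg i f x‖ₑ +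
          ∑' n : ℕ, (p : ℝ≥0∞) ^ (β * (i - n - 1)) * ‖ballDiff (i - n) h y‖ₑ) ∂padicHaar p :=
          lintegral_mono_set sphere_subset_closedBall
      _ = (p : ℝ≥0∞) ^ (i : ℝ) * ‖f x - ballAvg i f x‖ₑ +
          ∑' n : ℕ, (p : ℝ≥0∞) ^ (β * (i - n - 1)) *
            ∫⁻ y in closedBall x ((p : ℝ) ^ i), ‖ballDiff (i - n) h y‖ₑ ∂padicHaar p := by
          rw [lintegral_add_left measurable_const, setLIntegral_const, padicHaar_closedBall_zpow,
            ← ENNReal.rpow_intCast, mul_comm, lintegral_tsum fun n =>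
              ((hcont _).enorm.measurable.const_mul _).aemeasurable]
          congr 1
          exact tsum_congr fun n => lintegral_const_mul' _ _ (prime_rpow_ne_top _)
      _ ≤ _ := by
          gcongr with n
          · refine (hosc i x).trans (ENNReal.tsum_le_tsum fun n => ?_)
            gcongr
            have := enorm_ballDiff_le hloc x (i - n)
            push_cast at this
            exact this
          · exact lintegral_enorm_ballDiff_le hloc x (by lia)
  refine (lt_of_le_of_lt (ENNReal.tsum_le_tsum fun i => mul_le_mul_right (hbound i) _) ?_)
  simp_rw [fun a b c : ℝ≥0∞ => mul_add a b c, ENNReal.tsum_add, ← ENNReal.tsum_mul_left]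
  rw [ENNReal.add_lt_top]
  constructor
  · have h1 : ∀ (i : ℤ) (n : ℕ), (p : ℝ≥0∞) ^ (-(i * (α + β + 1))) * ((p : ℝ≥0∞) ^ (i : ℝ) *
        ((p : ℝ≥0∞) ^ (β * (i - n - 1)) * ((p : ℝ≥0∞) ^ (1 - (i - n) : ℝ) * (2 * A (i - n))))) =
        ((p : ℝ≥0∞) ^ (-(n * (α + β))) * ((p : ℝ≥0∞) ^ (1 - β) * 2)) *
          ((p : ℝ≥0∞) ^ (-((i - n : ℤ) * (α + 1))) * A (i - n)) := by
      intro i n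
      rw [← mul_assoc, ← prime_rpow_add, ← mul_assoc, ← prime_rpow_add, ← mul_assoc,
        ← prime_rpow_add, ← mul_assoc _ _ (2 : ℝ≥0∞), ← prime_rpow_add, mul_mul_mul_comm,
        ← prime_rpow_add, ← mul_assoc, ← mul_assoc]
      push_cast
      ring_nf
    simp_rw [h1]
    rw [tsum_int_tsum_nat_mul_sub _ fun i : ℤ => (p : ℝ≥0∞) ^ (-(i * (α + 1))) * A i,
      ENNReal.tsum_mul_right]
    exact ENNReal.mul_lt_top (ENNReal.mul_lt_top (tsum_prime_rpow_neg_ne_top (by linarith)).lt_top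
      (ENNReal.mul_lt_top (prime_rpow_ne_top _).lt_top ENNReal.ofNat_lt_top)) hAsum.lt_top
  · have h1 : ∀ (i : ℤ) (n : ℕ), (p : ℝ≥0∞) ^ (-(i * (α + β + 1))) *
        ((p : ℝ≥0∞) ^ (β * (i - n - 1)) * (2 * A i)) =
        ((p : ℝ≥0∞) ^ (-(n * β)) * ((p : ℝ≥0∞) ^ (-β) * 2)) *
          ((p : ℝ≥0∞) ^ (-(i * (α + 1))) * A i) := by
      intro i n
      rw [← mul_assoc, ← prime_rpow_add, ← mul_assoc _ _ (2 : ℝ≥0∞), ← prime_rpow_add,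
        mul_mul_mul_comm, ← prime_rpow_add, ← mul_assoc]
      ring_nf
    simp_rw [h1, ENNReal.tsum_mul_right, ENNReal.tsum_mul_left]
    exact ENNReal.mul_lt_top (ENNReal.mul_lt_top (tsum_prime_rpow_neg_ne_top hβ).lt_top
      (ENNReal.mul_lt_top (prime_rpow_ne_top _).lt_top ENNReal.ofNat_lt_top)) hAsum.lt_top

theorem vladimirov_vladimirov {α β : ℝ} (hα : 0 < α) (hβ : 0 < β) {f : ℚ_[p] → ℂ} {x : ℚ_[p]}
    (hf : ∀ y, VladimirovDefinedAt p β f y)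
    (hx : VladimirovDefinedAt p α (vladimirov p β f) x) :
    vladimirov p α (vladimirov p β f) x = vladimirov p (α + β) f x := by
  refine (hx.hasSum hα).unique (((VladimirovDefinedAt.add hα hβ hf hx).hasSum
    (add_pos hα hβ)).of_forall_eq fun k => ?_)
  rw [ballDiff_vladimirov hβ hf (hx.locallyIntegrable hα), smul_smul,
    ← Real.rpow_add cast_prime_pos, add_mul]

/-! ### Bounded uniformly locally constant functions -/

theorem exists_padic_zpow_lt {δ : ℝ} (hδ : 0 < δ) : ∃ k : ℤ, (p : ℝ) ^ k < δ := by
  obtain ⟨n, hn⟩ := exists_pow_lt_of_lt_one hδ (inv_lt_one_of_one_lt₀ (one_lt_cast_prime (p := p)))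
  exact ⟨-n, by simpa using hn⟩

/-- Local constancy is uniform for functions with compact support. -/
theorem IsLocallyConstant.exists_eq_of_norm_sub_le {f : ℚ_[p] → ℂ} (hf : IsLocallyConstant f)
    (hc : HasCompactSupport f) : ∃ k : ℤ, ∀ x y, ‖x - y‖ ≤ (p : ℝ) ^ k → f x = f y := by
  obtain ⟨δ, hδ, h⟩ := lebesgue_number_lemma_of_metric hc (c := fun v : ℂ => f ⁻¹' {v})
    (fun v => hf.isOpen_fiber v) fun x _ => Set.mem_iUnion.mpr ⟨f x, rfl⟩
  obtain ⟨k, hk⟩ := exists_padic_zpow_lt (p := p) hδ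
  have key : ∀ x y, x ∈ tsupport f → ‖x - y‖ ≤ (p : ℝ) ^ k → f x = f y := by
    intro x y hx hxy
    obtain ⟨v, hv⟩ := h x hx
    have h1 : f x = v := hv (mem_ball_self hδ)
    have h2 : f y = v := hv (by
      rw [mem_ball, dist_eq_norm, norm_sub_rev]; exact hxy.trans_lt hk)
    rw [h1, h2]
  refine ⟨k, fun x y hxy => ?_⟩
  by_cases hx : x ∈ tsupport f
  · exact key x y hx hxy
  by_cases hy : y ∈ tsupport f
  · exact (key y x hy (by rwa [norm_sub_rev])).symm
  · rw [image_eq_zero_of_notMem_tsupport hx, image_eq_zero_of_notMem_tsupport hy]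

/-- For `f` bounded and constant on balls of radius `p ^ k`, the integrals defining `D^α f` are
absolutely convergent, uniformly in the point. -/
theorem exists_lintegral_vladimirovIntegrand_le {α : ℝ} (hα : 0 < α) {f : ℚ_[p] → ℂ} {k : ℤ}
    {M : ℝ} (hM : ∀ x, ‖f x‖ ≤ M) (hk : ∀ x y, ‖x - y‖ ≤ (p : ℝ) ^ k → f x = f y) :
    ∃ C : ℝ≥0∞, C ≠ ∞ ∧
      ∀ x, ∫⁻ y, ‖vladimirovIntegrand p α f x y‖ₑ ∂padicHaar p ≤ C := by
  refine ⟨(∑' n : ℕ, (p : ℝ≥0∞) ^ (-(n * α))) *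
    ((p : ℝ≥0∞) ^ (-((k + 1) * α)) * ENNReal.ofReal (2 * M)),
    ENNReal.mul_ne_top (tsum_prime_rpow_neg_ne_top hα)
      (ENNReal.mul_ne_top (prime_rpow_ne_top _) ENNReal.ofReal_ne_top), fun x => ?_⟩
  rw [lintegral_enorm_vladimirovIntegrand, ← Function.Injective.tsum_eq
    (g := fun n : ℕ => k + 1 + (n : ℤ)) (fun a b hab => by simpa using hab),
    ← ENNReal.tsum_mul_right]
  · refine ENNReal.tsum_le_tsum fun n => ?_
    have h1 : ∫⁻ y in sphere x ((p : ℝ) ^ (k + 1 + (n : ℤ))), ‖f x - f y‖ₑ ∂padicHaar p ≤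
        ENNReal.ofReal (2 * M) * (p : ℝ≥0∞) ^ ((k + 1 + (n : ℤ) : ℤ) : ℝ) := by
      rw [ENNReal.rpow_intCast, ← padicHaar_closedBall_zpow x, ← setLIntegral_const]
      refine (lintegral_mono_set sphere_subset_closedBall).trans (lintegral_mono fun y => ?_)
      rw [← ofReal_norm]
      refine ENNReal.ofReal_le_ofReal ((norm_sub_le _ _).trans ?_)
      linarith [hM x, hM y]
    refine (mul_le_mul_right h1 _).trans_eq ?_
    rw [mul_left_comm, ← prime_rpow_add, mul_comm (ENNReal.ofReal _), ← mul_assoc, ← prime_rpow_add]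
    push_cast
    ring_nf
  · intro j hj
    rcases le_or_gt j k with hjk | hjk
    · refine absurd ?_ hj
      beta_reduce
      rw [setLIntegral_congr_fun (g := fun _ => 0) isClosed_sphere.measurableSet]
      · simp
      · intro y hy
        rw [mem_sphere, dist_eq_norm, norm_sub_rev] at hy
        simp only [hk x y (hy.trans_le (zpow_le_zpow_right₀ one_lt_cast_prime.le hjk)), sub_self,
          enorm_zero]
    · exact ⟨(j - k - 1).toNat, by simp only; lia⟩

theorem vladimirovDefinedAt_of_bounded {α : ℝ} (hα : 0 < α) {f : ℚ_[p] → ℂ} {k : ℤ}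
    {M : ℝ} (hM : ∀ x, ‖f x‖ ≤ M) (hk : ∀ x y, ‖x - y‖ ≤ (p : ℝ) ^ k → f x = f y) (x : ℚ_[p]) :
    VladimirovDefinedAt p α f x := by
  obtain ⟨C, hC, h⟩ := exists_lintegral_vladimirovIntegrand_le hα hM hk
  refine ⟨?_, (h x).trans_lt hC.lt_top⟩
  refine (aestronglyMeasurable_const.sub
    (continuous_of_eq_of_norm_sub_le hk).aestronglyMeasurable).div₀ ?_
  refine Measurable.aestronglyMeasurable ?_
  fun_prop

theorem exists_norm_vladimirov_le {α : ℝ} (hα : 0 < α) {f : ℚ_[p] → ℂ} {k : ℤ}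
    {M : ℝ} (hM : ∀ x, ‖f x‖ ≤ M) (hk : ∀ x y, ‖x - y‖ ≤ (p : ℝ) ^ k → f x = f y) :
    ∃ M', ∀ x, ‖vladimirov p α f x‖ ≤ M' := by
  obtain ⟨C, hC, h⟩ := exists_lintegral_vladimirovIntegrand_le hα hM hk
  refine ⟨‖((((p : ℝ) ^ α - 1) / (1 - (p : ℝ) ^ (-α - 1)) : ℝ) : ℂ)‖ * C.toReal, fun x => ?_⟩
  rw [vladimirov, norm_mul]
  refine mul_le_mul_of_nonneg_left ?_ (norm_nonneg _)
  rw [← toReal_enorm]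
  exact ENNReal.toReal_mono hC ((enorm_integral_le_lintegral_enorm _).trans (h x))

/-- `D^α` commutes with translations, hence keeps the radius of constancy. -/
theorem vladimirov_eq_of_norm_sub_le {α : ℝ} {f : ℚ_[p] → ℂ} {k : ℤ}
    (hk : ∀ x y, ‖x - y‖ ≤ (p : ℝ) ^ k → f x = f y) (x y : ℚ_[p]) (hxy : ‖x - y‖ ≤ (p : ℝ) ^ k) :
    vladimirov p α f x = vladimirov p α f y := by
  rw [vladimirov, vladimirov, ← integral_add_right_eq_self _ (x - y)]
  congr 2
  ext z
  rw [vladimirovIntegrand, vladimirovIntegrand, hk x y hxy, hk (z + (x - y)) z (by simpa using hxy),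
    show x - (z + (x - y)) = y - z by ring]

/-! ### Powers of the norm -/

theorem prime_cast_complex_ne_zero : (p : ℂ) ≠ 0 := mod_cast hp.out.ne_zero

theorem norm_prime_cpow (s : ℂ) : ‖(p : ℂ) ^ s‖ = (p : ℝ) ^ s.re :=
  Complex.norm_natCast_cpow_of_pos hp.out.pos s

theorem prime_cpow_ne_one {s : ℂ} (hs : s.re ≠ 0) : (p : ℂ) ^ s ≠ 1 := by
  intro h
  have h1 := norm_prime_cpow (p := p) s
  rw [h, norm_one, ← Real.rpow_zero (p : ℝ)] at h1
  exact hs ((Real.rpow_right_inj cast_prime_pos one_lt_cast_prime.ne').mp h1).symm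

omit hp in
theorem prime_zpow_cpow (k : ℤ) (s : ℂ) :
    (((p : ℝ) ^ k : ℝ) : ℂ) ^ s = ((p : ℂ) ^ s) ^ k := by
  have h : (Complex.log p * (k : ℂ)).im = 0 := by
    rw [← Complex.natCast_log, ← Complex.ofReal_intCast, ← Complex.ofReal_mul, Complex.ofReal_im]
  rw [← Complex.cpow_int_mul, Complex.cpow_mul _ (by rw [h]; linarith [Real.pi_pos])
    (by rw [h]; exact Real.pi_pos.le), Complex.cpow_intCast]
  push_cast
  rfl

/-- The factor by which `D^α` acts on `|·|_p ^ s`, that is `Γ_p(s + 1) / Γ_p(s - α + 1)`, times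
`X ^ (s - α)`, for complex `s`. -/
noncomputable def vladimirovPowValue (p : ℕ) (α X : ℝ) (s : ℂ) : ℂ :=
  (1 - (p : ℂ) ^ s) * (1 - (p : ℂ) ^ (α - 1 - s)) /
    ((1 - (p : ℂ) ^ (-1 - s)) * (1 - (p : ℂ) ^ (s - α))) * (X : ℂ) ^ (s - α)

/-- The integrand for `D^α |·|_p ^ s (x)` is constant on spheres about `0`: off the sphere through
`x` the ultrametric inequality gives `‖x - y‖ = max ‖x‖ ‖y‖`, and on it the numerator is `0`. -/
theorem vladimirovIntegrand_padicNormPow {α : ℝ} {s : ℂ} {x y : ℚ_[p]} {m j : ℤ}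
    (hx : ‖x‖ = (p : ℝ) ^ m) (hy : y ∈ sphere 0 ((p : ℝ) ^ (m + j))) :
    vladimirovIntegrand p α (padicNormPow p s) x y =
      (((p : ℝ) ^ m : ℝ) : ℂ) ^ s * (1 - ((p : ℂ) ^ s) ^ j) *
        (((p : ℝ) ^ (-((m + max j 0 : ℤ) * (α + 1))) : ℝ) : ℂ) := by
  rw [mem_sphere, dist_eq_norm, sub_zero] at hy
  rw [vladimirovIntegrand, padicNormPow, padicNormPow, hx, hy, prime_zpow_cpow, prime_zpow_cpow,
    zpow_add₀ (by simp [Complex.cpow_eq_zero_iff, hp.out.ne_zero]), ← mul_one_sub]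
  rcases eq_or_ne j 0 with rfl | hj
  · simp
  have hne : ‖x‖ ≠ ‖y‖ := by
    rw [hx, hy]
    exact fun h => hj (by
      have := zpow_right_injective₀ cast_prime_pos (one_lt_cast_prime (p := p)).ne' h
      lia)
  have hxy : ‖x - y‖ = (p : ℝ) ^ (m + max j 0) := by
    have h1 := IsUltrametricDist.norm_add_eq_max_of_norm_ne_norm (x := x) (y := -y)
      (by rwa [norm_neg])
    rw [← sub_eq_add_neg, norm_neg, hx, hy] at h1
    rw [h1, ← (zpow_right_mono₀ (one_lt_cast_prime (p := p)).le).map_max]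
    congr 1
    lia
  rw [hxy, ← Real.rpow_intCast, ← Real.rpow_mul cast_prime_pos.le, Real.rpow_neg cast_prime_pos.le,
    Complex.ofReal_inv, div_eq_mul_inv]

theorem hasSum_pow_succ {r : ℂ} (hr : ‖r‖ < 1) :
    HasSum (fun n : ℕ => r ^ (n + 1)) (r / (1 - r)) := by
  simpa only [pow_succ', div_eq_mul_inv] using (hasSum_geometric_of_norm_lt_one hr).mul_left r

theorem setIntegral_vladimirovIntegrand_padicNormPow {α : ℝ} {s : ℂ} {x : ℚ_[p]} {m : ℤ}
    (hx : ‖x‖ = (p : ℝ) ^ m) (j : ℤ) :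
    ∫ y in sphere 0 ((p : ℝ) ^ (m + j)), vladimirovIntegrand p α (padicNormPow p s) x y
      ∂padicHaar p = ((1 - (p : ℂ)⁻¹) * (((p : ℝ) ^ m : ℝ) : ℂ) ^ (s - α)) *
        ((1 - ((p : ℂ) ^ s) ^ j) *
          ((p : ℂ) ^ j * (((p : ℝ) ^ (-(max j 0 * (α + 1))) : ℝ) : ℂ))) := by
  have hp0 := cast_prime_pos (p := p)
  have hpm : (((p : ℝ) ^ m : ℝ) : ℂ) ≠ 0 := by
    rw [Complex.ofReal_ne_zero]; exact (zpow_pos hp0 m).ne'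
  rw [setIntegral_congr_fun isClosed_sphere.measurableSet fun y hy =>
    vladimirovIntegrand_padicNormPow hx hy, setIntegral_const, padicHaar_real_sphere,
    Complex.cpow_sub _ _ hpm, ← Complex.ofReal_cpow (zpow_nonneg hp0.le m)]
  have h1 : (p : ℝ) ^ (m + j) * (p : ℝ) ^ (-((m + max j 0 : ℤ) * (α + 1))) =
      (((p : ℝ) ^ m) ^ α)⁻¹ * ((p : ℝ) ^ j * (p : ℝ) ^ (-(max j 0 * (α + 1)))) := by
    simp only [← Real.rpow_intCast]
    rw [← Real.rpow_mul hp0.le, ← Real.rpow_neg hp0.le, ← Real.rpow_add hp0, ← Real.rpow_add hp0,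
      ← Real.rpow_add hp0]
    push_cast
    ring_nf
  have h2 := congrArg (fun r : ℝ => (r : ℂ)) h1
  push_cast at h2
  rw [Complex.real_smul]
  push_cast
  linear_combination ((1 - (p : ℂ)⁻¹) * ((p : ℂ) ^ m) ^ s * (1 - ((p : ℂ) ^ s) ^ j)) * h2

/-- The sum over the spheres about `0`, split at the sphere through `x` into geometric series; the
two bounds on `Re s` are what makes them converge. -/
theorem hasSum_setIntegral_padicNormPow {α : ℝ} {s : ℂ} (hα : 0 < α) (hs1 : -1 < s.re)
    (hs2 : s.re < α) :
    HasSum (fun j : ℤ => (1 - ((p : ℂ) ^ s) ^ j) *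
        ((p : ℂ) ^ j * (((p : ℝ) ^ (-(max j 0 * (α + 1))) : ℝ) : ℂ)))
      ((p : ℂ) ^ (-α : ℂ) / (1 - (p : ℂ) ^ (-α : ℂ)) - (p : ℂ) ^ (s - α) / (1 - (p : ℂ) ^ (s - α)) +
        0 + ((p : ℂ) ^ (-1 : ℂ) / (1 - (p : ℂ) ^ (-1 : ℂ)) -
          (p : ℂ) ^ (-1 - s) / (1 - (p : ℂ) ^ (-1 - s)))) := by
  have hpc := prime_cast_complex_ne_zero (p := p)
  have hlt : ∀ w : ℂ, w.re < 0 → ‖(p : ℂ) ^ w‖ < 1 := fun w hw => by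
    rw [norm_prime_cpow]
    exact Real.rpow_lt_one_of_one_lt_of_neg one_lt_cast_prime hw
  have h1 := (hasSum_pow_succ (hlt (-α) (by simpa using hα))).sub
    (hasSum_pow_succ (hlt (s - α) (by simpa using hs2)))
  have h2 := (hasSum_pow_succ (hlt (-1) (by simp))).sub
    (hasSum_pow_succ (hlt (-1 - s) (by simp; linarith)))
  have h3 := HasSum.of_add_one_of_neg_add_one (f := fun j : ℤ => (1 - ((p : ℂ) ^ s) ^ j) *
        ((p : ℂ) ^ j * (((p : ℝ) ^ (-(max j 0 * (α + 1))) : ℝ) : ℂ))) (h1.of_forall_eq fun n => ?_)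
        (h2.of_forall_eq fun n => ?_)
  · simpa using h3
  · rw [max_eq_left (by lia), Complex.ofReal_cpow cast_prime_pos.le]
    simp only [← Complex.cpow_intCast (p : ℂ), ← Complex.cpow_int_mul, ← Complex.cpow_nat_mul]
    push_cast
    rw [← Complex.cpow_add _ _ hpc, one_sub_mul, ← Complex.cpow_add _ _ hpc]
    ring_nf
  · rw [max_eq_right (by lia)]
    simp only [← Complex.cpow_intCast (p : ℂ), ← Complex.cpow_int_mul, ← Complex.cpow_nat_mul]
    push_cast
    rw [zero_mul, neg_zero, Real.rpow_zero, Complex.ofReal_one, mul_one, one_sub_mul,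
      ← Complex.cpow_add _ _ hpc]
    ring_nf

theorem vladimirovDefinedAt_padicNormPow {α : ℝ} {s : ℂ} {x : ℚ_[p]} (hα : 0 < α)
    (hs1 : -1 < s.re) (hs2 : s.re < α) (hx : x ≠ 0) :
    VladimirovDefinedAt p α (padicNormPow p s) x := by
  have hm := Padic.norm_eq_zpow_neg_valuation hx
  set m := -x.valuation
  have hU : ⋃ j : ℤ, sphere (0 : ℚ_[p]) ((p : ℝ) ^ (m + j)) = {0}ᶜ := by
    rw [← iUnion_padic_sphere]
    exact (Equiv.addLeft m).surjective.iUnion_comp fun k => sphere (0 : ℚ_[p]) ((p : ℝ) ^ k)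
  have htop : ∀ k : ℤ, padicHaar p (sphere 0 ((p : ℝ) ^ k)) ≠ ∞ := fun k =>
    measure_ne_top_of_subset sphere_subset_closedBall (padicHaar_closedBall_ne_top _ _)
  rw [VladimirovDefinedAt, ← integrableOn_univ, ← integrableOn_congr_set_ae
    (compl_mem_ae_iff.mpr (measure_singleton (0 : ℚ_[p])) |> eventuallyEq_univ.mpr), ← hU]
  refine integrableOn_iUnion_of_summable_integral_norm (fun j => ?_) ?_
  · exact (integrableOn_congr_fun (fun y hy => vladimirovIntegrand_padicNormPow hm hy)
      isClosed_sphere.measurableSet).mpr (integrableOn_const (htop _))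
  · refine ((hasSum_setIntegral_padicNormPow (p := p) hα hs1 hs2).mul_left
      ((1 - (p : ℂ)⁻¹) * (((p : ℝ) ^ m : ℝ) : ℂ) ^ (s - α))).summable.norm.congr fun j => ?_
    rw [← setIntegral_vladimirovIntegrand_padicNormPow hm, setIntegral_congr_fun
      isClosed_sphere.measurableSet fun y hy => vladimirovIntegrand_padicNormPow hm hy,
      setIntegral_congr_fun (g := fun _ => ‖_‖) isClosed_sphere.measurableSet fun y hy =>
        congrArg norm (vladimirovIntegrand_padicNormPow hm hy), setIntegral_const,
      setIntegral_const, norm_smul, smul_eq_mul, Real.norm_of_nonneg measureReal_nonneg]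

theorem vladimirov_padicNormPow {α : ℝ} {s : ℂ} {x : ℚ_[p]} (hα : 0 < α)
    (hs1 : -1 < s.re) (hs2 : s.re < α) (hx : x ≠ 0) :
    vladimirov p α (padicNormPow p s) x = vladimirovPowValue p α ‖x‖ s := by
  have hm := Padic.norm_eq_zpow_neg_valuation hx
  set m := -x.valuation
  have h1 := (Equiv.addLeft m).hasSum_iff.mpr
    (hasSum_integral_padic_sphere (vladimirovDefinedAt_padicNormPow hα hs1 hs2 hx) 0)
  have h2 := (hasSum_setIntegral_padicNormPow (p := p) hα hs1 hs2).mul_left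
    ((1 - (p : ℂ)⁻¹) * (((p : ℝ) ^ m : ℝ) : ℂ) ^ (s - α))
  have h3 := h1.unique (h2.of_forall_eq fun j => setIntegral_vladimirovIntegrand_padicNormPow hm j)
  rw [vladimirov, h3, vladimirovPowValue, ← hm]
  have hP := prime_cast_complex_ne_zero (p := p)
  have hne : ∀ w : ℂ, w.re ≠ 0 → 1 - (p : ℂ) ^ w ≠ 0 := fun w hw =>
    sub_ne_zero.mpr (prime_cpow_ne_one hw).symm
  have n1 := hne (-α) (by simpa using hα.ne')
  have n2 := hne (s - α) (by simpa [sub_eq_zero] using hs2.ne)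
  have n3 := hne (-1) (by simp)
  have n4 := hne (-1 - s) (by simp; intro h; linarith)
  have n5 := hne (-α - 1) (by simp; intro h; linarith)
  have hC : ((((p : ℝ) ^ α - 1) / (1 - (p : ℝ) ^ (-α - 1)) : ℝ) : ℂ) =
      ((p : ℂ) ^ (α : ℂ) - 1) / (1 - (p : ℂ) ^ (-α - 1 : ℂ)) := by
    push_cast [Complex.ofReal_cpow cast_prime_pos.le]
    rfl
  rw [hC]
  have hA : (p : ℂ) ^ (α : ℂ) ≠ 0 := by simp [Complex.cpow_eq_zero_iff, hP]
  have ht : (p : ℂ) ^ s ≠ 0 := by simp [Complex.cpow_eq_zero_iff, hP]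
  simp only [Complex.cpow_sub _ _ hP, Complex.cpow_neg, Complex.cpow_one] at n1 n2 n3 n4 n5 ⊢
  generalize (p : ℂ) ^ (α : ℂ) = A at *
  generalize (p : ℂ) ^ s = t at *
  generalize ((‖x‖ : ℝ) : ℂ) ^ (s - α) = X at *
  have d1 : A - 1 ≠ 0 := fun h => n1 (by rw [sub_eq_zero.mp h]; simp)
  have d2 : A - t ≠ 0 := fun h => n2 (by rw [sub_eq_zero.mp h, div_self ht, sub_self])
  have d3 : (p : ℂ) - 1 ≠ 0 := fun h => n3 (by rw [sub_eq_zero.mp h]; simp)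
  have d4 : (p : ℂ) * t - 1 ≠ 0 := fun h => n4 (by field_simp; linear_combination h)
  have d5 : A * (p : ℂ) - 1 ≠ 0 := fun h => n5 (by field_simp; linear_combination h)
  have e1 : A⁻¹ / (1 - A⁻¹) = 1 / (A - 1) := by field_simp
  have e2 : t / A / (1 - t / A) = t / (A - t) := by field_simp
  have e3 : (p : ℂ)⁻¹ / (1 - (p : ℂ)⁻¹) = 1 / ((p : ℂ) - 1) := by field_simp
  have e4 : (p : ℂ)⁻¹ / t / (1 - (p : ℂ)⁻¹ / t) = 1 / ((p : ℂ) * t - 1) := by field_simp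
  have e5 : (A - 1) / (1 - A⁻¹ / p) = (A - 1) * (A * p) / (A * p - 1) := by field_simp
  have e6 : (1 - t) * (1 - A / p / t) / ((1 - (p : ℂ)⁻¹ / t) * (1 - t / A)) =
      (1 - t) * (p * t - A) * A / ((p * t - 1) * (A - t)) := by field_simp
  rw [e1, e2, e3, e4, e5, e6]
  field_simp
  ring

theorem countable_prime_cpow_eq_one : {w : ℂ | (p : ℂ) ^ w = 1}.Countable := by
  have hlog : Complex.log (p : ℂ) ≠ 0 := by
    rw [← Complex.natCast_log]
    exact Complex.ofReal_ne_zero.mpr (Real.log_pos one_lt_cast_prime).ne'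
  refine (Set.countable_range fun n : ℤ => n * (2 * Real.pi * Complex.I) / Complex.log p).mono ?_
  intro w hw
  rw [Set.mem_ofPred_eq, Complex.cpow_def_of_ne_zero prime_cast_complex_ne_zero,
    Complex.exp_eq_one_iff] at hw
  obtain ⟨n, hn⟩ := hw
  exact ⟨n, by simp only [← hn]; field_simp⟩

theorem analyticAt_prime_cpow {g : ℂ → ℂ} {z : ℂ} (hg : AnalyticAt ℂ g z) :
    AnalyticAt ℂ (fun s : ℂ => (p : ℂ) ^ g s) z := by
  simp only [Complex.cpow_def_of_ne_zero (prime_cast_complex_ne_zero (p := p))]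
  fun_prop

/-- The poles of the continuation of `s ↦ D^α |·|_p ^ s`. -/
def vladimirovPowPoles (p : ℕ) (α : ℝ) : Set ℂ :=
  {s | (p : ℂ) ^ (-1 - s) = 1} ∪ {s | (p : ℂ) ^ (s - α) = 1}

theorem isConnected_compl_vladimirovPowPoles (α : ℝ) :
    IsConnected (vladimirovPowPoles p α)ᶜ := by
  refine Set.Countable.isConnected_compl_of_one_lt_rank (by simp) (Set.Countable.union ?_ ?_)
  · exact countable_prime_cpow_eq_one.preimage (f := fun s : ℂ => -1 - s) sub_right_injective
  · exact countable_prime_cpow_eq_one.preimage (f := fun s : ℂ => s - α) sub_left_injective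

theorem isOpen_compl_vladimirovPowPoles (α : ℝ) : IsOpen (vladimirovPowPoles p α)ᶜ := by
  have hc : ∀ g : ℂ → ℂ, Continuous g → IsClosed {s | (p : ℂ) ^ g s = 1} := fun g hg =>
    isClosed_eq (hg.const_cpow (Or.inl prime_cast_complex_ne_zero)) continuous_const
  exact ((hc _ (by fun_prop)).union (hc _ (by fun_prop))).isOpen_compl

theorem notMem_vladimirovPowPoles {α : ℝ} {s : ℂ} (h1 : -1 < s.re) (h2 : s.re ≠ α) :
    s ∉ vladimirovPowPoles p α := by
  rintro (h | h)
  · exact prime_cpow_ne_one (by simp; intro h; linarith) h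
  · exact prime_cpow_ne_one (by simpa [sub_eq_zero] using h2) h

theorem analyticAt_real_cpow_sub {X : ℝ} (hX : 0 < X) (α : ℝ) (z : ℂ) :
    AnalyticAt ℂ (fun s : ℂ => (X : ℂ) ^ (s - α)) z := by
  simp only [Complex.cpow_def_of_ne_zero (Complex.ofReal_ne_zero.mpr hX.ne')]
  fun_prop

/-- `vladimirovPowValue` is a quotient of entire functions: its numerator. -/
theorem analyticAt_vladimirovPow_numerator {X : ℝ} (hX : 0 < X) (α : ℝ) (z : ℂ) :
    AnalyticAt ℂ (fun s : ℂ => (1 - (p : ℂ) ^ s) * (1 - (p : ℂ) ^ (α - 1 - s)) * (X : ℂ) ^ (s - α))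
      z :=
  ((analyticAt_const.sub (analyticAt_prime_cpow analyticAt_id)).mul
    (analyticAt_const.sub (analyticAt_prime_cpow (by fun_prop)))).mul
    (analyticAt_real_cpow_sub hX α z)

/-- `vladimirovPowValue` is a quotient of entire functions: its denominator. -/
theorem analyticAt_vladimirovPow_denominator (α : ℝ) (z : ℂ) :
    AnalyticAt ℂ (fun s : ℂ => (1 - (p : ℂ) ^ (-1 - s)) * (1 - (p : ℂ) ^ (s - α))) z :=
  (analyticAt_const.sub (analyticAt_prime_cpow (by fun_prop))).mul
    (analyticAt_const.sub (analyticAt_prime_cpow (by fun_prop)))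

omit hp in
theorem vladimirovPow_denominator_ne_zero {α : ℝ} {s : ℂ} (hs : s ∉ vladimirovPowPoles p α) :
    (1 - (p : ℂ) ^ (-1 - s)) * (1 - (p : ℂ) ^ (s - α)) ≠ 0 :=
  mul_ne_zero (sub_ne_zero.mpr fun h => hs (Or.inl h.symm))
    (sub_ne_zero.mpr fun h => hs (Or.inr h.symm))

/-- The continued value of `D^α |·|_p ^ n` at `x ≠ 0`. -/
theorem isContinuedVladimirovPow_iff {α : ℝ} {n : ℕ} {x : ℚ_[p]} (hα : 0 < α) (hn : α ≠ n)
    (hx : x ≠ 0) (v : ℂ) :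
    IsContinuedVladimirovPow p α n x v ↔ v = vladimirovPowValue p α ‖x‖ n := by
  have hX : 0 < ‖x‖ := norm_pos_iff.mpr hx
  have hnpole : (n : ℂ) ∉ vladimirovPowPoles p α :=
    notMem_vladimirovPowPoles (by simp; linarith [n.cast_nonneg (α := ℝ)]) (by simpa using hn.symm)
  constructor
  · rintro ⟨U, F, hU, hUc, hSU, hnU, hF, hFS, rfl⟩
    have hS : IsOpen {s : ℂ | -1 < s.re ∧ s.re < α} :=
      (isOpen_lt continuous_const Complex.continuous_re).inter
        (isOpen_lt Complex.continuous_re continuous_const)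
    have h0 : (0 : ℂ) ∈ {s : ℂ | -1 < s.re ∧ s.re < α} := by simpa using hα
    -- clearing denominators leaves an identity between functions analytic on all of `U`
    have hev : (fun s => F s * ((1 - (p : ℂ) ^ (-1 - s)) * (1 - (p : ℂ) ^ (s - α)))) =ᶠ[𝓝 0]
        fun s => (1 - (p : ℂ) ^ s) * (1 - (p : ℂ) ^ (α - 1 - s)) * (‖x‖ : ℂ) ^ (s - α) := by
      filter_upwards [hS.mem_nhds h0] with s hs
      have hd := vladimirovPow_denominator_ne_zero (p := p)
        (notMem_vladimirovPowPoles hs.1 hs.2.ne)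
      rw [hFS hs]
      beta_reduce
      rw [vladimirov_padicNormPow hα hs.1 hs.2 hx, vladimirovPowValue, div_mul_eq_mul_div,
        div_mul_cancel₀ _ hd]
    have h1 := AnalyticOnNhd.eqOn_of_preconnected_of_eventuallyEq
      (fun z hz => (hF z hz).mul (analyticAt_vladimirovPow_denominator α z))
      (fun z _ => analyticAt_vladimirovPow_numerator hX α z) hUc.isPreconnected (hSU h0) hev hnU
    rw [vladimirovPowValue, div_mul_eq_mul_div, eq_div_iff
      (vladimirovPow_denominator_ne_zero hnpole)]
    exact h1
  · rintro rfl
    refine ⟨(vladimirovPowPoles p α)ᶜ, vladimirovPowValue p α ‖x‖,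
      isOpen_compl_vladimirovPowPoles α, isConnected_compl_vladimirovPowPoles α,
      fun s hs => notMem_vladimirovPowPoles hs.1 hs.2.ne, hnpole, fun z hz => ?_,
      fun s hs => (vladimirov_padicNormPow hα hs.1 hs.2 hx).symm, rfl⟩
    refine ((analyticAt_vladimirovPow_numerator (p := p) hX α z).div
      (analyticAt_vladimirovPow_denominator α z)
      (vladimirovPow_denominator_ne_zero hz)).congr (Eventually.of_forall fun s => ?_)
    rw [Pi.div_apply, vladimirovPowValue, div_mul_eq_mul_div]

theorem vladimirovPowValue_natCast {X : ℝ} (hX : 0 ≤ X) (α : ℝ) (n : ℕ) :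
    vladimirovPowValue p α X n =
      ((padicGamma p (n + 1) / padicGamma p (n - α + 1) * X ^ ((n : ℝ) - α) : ℝ) : ℂ) := by
  rw [padicGamma, padicGamma, div_div_div_eq, vladimirovPowValue,
    show (n : ℝ) + 1 - 1 = n by ring, show (n : ℝ) - α + 1 - 1 = n - α by ring,
    show -((n : ℝ) + 1) = -1 - n by ring, show -((n : ℝ) - α + 1) = α - 1 - n by ring]
  push_cast [Complex.ofReal_cpow cast_prime_pos.le, Complex.ofReal_cpow hX]
  rfl

omit hp in
/-- At `α = n + 1` the factor `1 - p ^ (α - 1 - n)` vanishes. -/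
theorem vladimirovPowValue_eq_zero (X : ℝ) (n : ℕ) :
    vladimirovPowValue p (n + 1) X n = 0 := by
  simp [vladimirovPowValue]

theorem vladimirov_norm_pow {α : ℝ} {n : ℕ} {x : ℚ_[p]} (hn : (n : ℝ) < α) (hx : x ≠ 0) :
    vladimirov p α (fun y => ((‖y‖ ^ n : ℝ) : ℂ)) x = vladimirovPowValue p α ‖x‖ n := by
  have hn0 : (0 : ℝ) ≤ n := n.cast_nonneg
  rw [← vladimirov_padicNormPow (by linarith) (by simp; linarith) (by simpa using hn) hx]
  congr 1
  ext y
  simp [padicNormPow]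

end

theorem proposition8 (p : ℕ) [Fact p.Prime] :
    -- (1) the semigroup law, at every point where the left-hand side is defined ...
    (∀ α β : ℝ, 0 < α → 0 < β →
      (∀ (f : ℚ_[p] → ℂ) (x : ℚ_[p]),
        (∀ y, VladimirovDefinedAt p β f y) →
        VladimirovDefinedAt p α (vladimirov p β f) x →
          VladimirovDefinedAt p (α + β) f x ∧
          vladimirov p α (vladimirov p β f) x = vladimirov p (α + β) f x) ∧
      -- ... and unconditionally for locally constant functions with compact support
      (∀ f : ℚ_[p] → ℂ, IsLocallyConstant f → HasCompactSupport f → ∀ x,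
        VladimirovDefinedAt p β f x ∧
        VladimirovDefinedAt p α (vladimirov p β f) x ∧
        VladimirovDefinedAt p (α + β) f x ∧
        vladimirov p α (vladimirov p β f) x = vladimirov p (α + β) f x)) ∧
    -- (2) the action on powers of the norm
    (∀ (n : ℕ) (α : ℝ) (x : ℚ_[p]), 0 < α → x ≠ 0 →
      -- the integral converges in the strip from which it is continued
      (∀ s : ℂ, -1 < s.re → s.re < α → VladimirovDefinedAt p α (padicNormPow p s) x) ∧
      -- the formula, off the zero and the pole of the Gamma function in the denominator
      (α ≠ n → α ≠ n + 1 →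
        ((n : ℝ) < α →
          vladimirov p α (fun y => ((‖y‖ ^ n : ℝ) : ℂ)) x =
            ((padicGamma p (n + 1) / padicGamma p (n - α + 1) * ‖x‖ ^ ((n : ℝ) - α) : ℝ) : ℂ)) ∧
        (∀ v : ℂ, IsContinuedVladimirovPow p α n x v ↔
          v = ((padicGamma p (n + 1) / padicGamma p (n - α + 1) *
            ‖x‖ ^ ((n : ℝ) - α) : ℝ) : ℂ))) ∧
      -- at the pole of the Gamma function in the denominator the value is zero
      (α = n + 1 →
        vladimirov p α (fun y => ((‖y‖ ^ n : ℝ) : ℂ)) x = 0 ∧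
        (∀ v : ℂ, IsContinuedVladimirovPow p α n x v ↔ v = 0))) := by
  refine ⟨fun α β hα hβ => ⟨fun f x hf hx => ⟨hx.add hα hβ hf, vladimirov_vladimirov hα hβ hf hx⟩,
    fun f hf hc x => ?_⟩, fun n α x hα hx => ⟨fun s hs1 hs2 =>
      vladimirovDefinedAt_padicNormPow hα hs1 hs2 hx, fun hn _ => ⟨fun hlt => ?_, fun v => ?_⟩, ?_⟩⟩
  · obtain ⟨k, hk⟩ := hf.exists_eq_of_norm_sub_le hc
    obtain ⟨M, hM⟩ := hc.exists_bound_of_continuous hf.continuous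
    obtain ⟨M', hM'⟩ := exists_norm_vladimirov_le hβ hM hk
    have h1 := vladimirovDefinedAt_of_bounded hβ hM hk
    have h2 := vladimirovDefinedAt_of_bounded hα hM' (vladimirov_eq_of_norm_sub_le hk) x
    exact ⟨h1 x, h2, h2.add hα hβ h1, vladimirov_vladimirov hα hβ h1 h2⟩
  · rw [vladimirov_norm_pow hlt hx, vladimirovPowValue_natCast (norm_nonneg x)]
  · rw [isContinuedVladimirovPow_iff hα hn hx, vladimirovPowValue_natCast (norm_nonneg x)]
  · rintro rfl
    refine ⟨?_, fun v => ?_⟩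
    · rw [vladimirov_norm_pow (by linarith) hx, vladimirovPowValue_eq_zero]
    · rw [isContinuedVladimirovPow_iff hα (by linarith) hx, vladimirovPowValue_eq_zero]
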